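/- Let $p_1,\dots,p_N,q_1,\dots,q_N,g_1,\dots,g_m\in\mathbb R[x_1,\dots,x_n]$, let $\mathbf K=\{x\in\mathbb R^n: g_j(x)\ge 0,\ j=1,\dots,m\}$ be compact, and let $M>0$ be such that $\|x\|^2\le M$ for all $x\in\mathbf K$. Let $\{1,\dots,n\}=\bigcup_{i=1}^N I_i$ and put $g_{m+i}(x)=M-\sum_{l\in I_i}x_l^2$ for $i=1,\dots,N$. Let $J_1,\dots,J_N$ be a partition of $\{1,\dots,m+N\}$ with $m+i\in J_i$, such that $p_i$, $q_i$ and $g_j$ ($j\in J_i$) only involve the variables $x_l$, $l\in I_i$. Let $\mathbf K_i=\{z\in\mathbb R^{I_i}: g_j(z)\ge0,\ j\in J_i\}$ and assume that $q_i>0$ on $\mathbf K_i$ for every $i$. Write $f=\sum_{i=1}^N p_i/q_i$ and $f^*=\inf_{x\in\mathbf K}f(x)$. Assume the running intersection property: for every $i=2,\dots,N$ there is $j\le i-1$ with $I_i\cap\bigcup_{l<i}I_l\subseteq I_j$. For a real sequence $y=(y_\alpha)_{\alpha\in\mathbb N^n}$ let $L_y(\sum_\alpha h_\alpha x^\alpha)=\sum_\alpha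 h_\alpha y_\alpha$. For $I\subseteq\{1,\dots,n\}$ and a polynomial $h$, let $M_k(y,I)=(y_{\alpha+\beta})$ and $M_k(h\,y,I)=(L_y(h\,x^{\alpha+\beta}))$, with rows and columns indexed by the $\alpha,\beta\in\mathbb N^n$ supported in $I$ with $|\alpha|,|\beta|\le k$. Let $r_j=\lceil\deg g_j/2\rceil$ and $v_i=\max_{j\in J_i}r_j$. For every $k$ with $2k\ge\deg q_i$ ($1\le i\le N$) and $k\ge r_j$ ($1\le j\le m+N$), let $f^*_k\in[-\infty,+\infty]$ be the infimum of $\sum_{i=1}^N L_{y_i}(p_i)$ over all $N$-tuples of sequences $(y_1,\dots,y_N)$ such that $$M_k(y_i,I_i)\succeq0,\qquad M_{k-r_j}(g_j\,y_i,I_i)\succeq0\ (j\in J_i),\qquad L_{y_i}(q_i)=1\qquad(i=1,\dots,N),$$ $$L_{y_i}(x^\alpha q_i)=L_{y_j}(x^\alpha q_j)$$ for all $i<j$ with $I_i\cap I_j\ne\emptyset$ and all $\alpha$ supported in $I_i\cap I_j$ with $|\alpha|+\max(\deg q_i,\deg q_j)\le 2k$. Then: (a) $f^*_k$ is nondecreasing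 in $k$ and $f^*_k\to f^*$ as $k\to\infty$. (b) Let $k$ be such an order with, moreover, $2k\ge 1+\max(\deg q_i,\deg q_j)$ for all $i<j$ with $I_i\cap I_j\neq\emptyset$, and let $(y_1,\dots,y_N)$ be an optimal solution of the relaxation of order $k$ with $$\operatorname{rank}M_k(y_i,I_i)=\operatorname{rank}M_{k-v_i}(y_i,I_i)=:R_i\qquad(i=1,\dots,N)$$ and $\operatorname{rank}M_k(y_i,I_i\cap I_j)=\operatorname{rank}M_k(y_j,I_i\cap I_j)=1$ for all $i<j$ with $I_i\cap I_j\ne\emptyset$. Then $f^*_k=f^*$, and finitely many global minimizers can be extracted from the solution: for every $i$ there is a set $\Delta_i\subseteq\mathbf K_i$ of exactly $R_i$ points and positive weights $(w_{i,z})_{z\in\Delta_i}$ such that $y_{i,\alpha}=\sum_{z\in\Delta_i}w_{i,z}z^\alpha$ for all $\alpha$ supported in $I_i$ with $|\alpha|\le2k$; and the set of all $x\in\mathbb R^n$ with $(x_l)_{l\in I_i}\in\Delta_i$ for every $i$ is finite, nonempty, and consists of global minimizers of $f$ on $\mathbf K$. -/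

import Mathlib

open MvPolynomial

/-- `monos I k`: the exponents `α ∈ ℕⁿ` with `α_l = 0` for `l ∉ I` and `|α| ≤ k`. -/
def monos {n : ℕ} (I : Finset (Fin n)) (k : ℕ) : Finset (Fin n →₀ ℕ) :=
  (Finset.range (k + 1)).biUnion fun d => I.finsuppAntidiag d

theorem mem_monos {n : ℕ} {I : Finset (Fin n)} {k : ℕ} {α : Fin n →₀ ℕ} :
    α ∈ monos I k ↔ α.support ⊆ I ∧ α.degree ≤ k := by
  simp only [monos, Finset.mem_biUnion, Finset.mem_range, Finset.mem_finsuppAntidiag]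
  constructor
  · rintro ⟨d, hd, hs, hI⟩
    refine ⟨hI, ?_⟩
    have h : α.degree = I.sum α := by
      rw [Finsupp.degree_apply]
      exact Finset.sum_subset hI fun x _ hx => by simpa using hx
    omega
  · rintro ⟨hI, hd⟩
    refine ⟨α.degree, by omega, ?_, hI⟩
    rw [Finsupp.degree_apply]
    exact (Finset.sum_subset hI fun x _ hx => by simpa using hx).symm

/-- The linear functional `L_y f = ∑_α f_α y_α`. -/
noncomputable def rieszL {n : ℕ} (y : (Fin n →₀ ℕ) → ℝ) (f : MvPolynomial (Fin n) ℝ) : ℝ :=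
  ∑ α ∈ f.support, f.coeff α * y α

/-- The sparse moment matrix `M_k(y, I)`. -/
noncomputable def momentMatrix {n : ℕ} (y : (Fin n →₀ ℕ) → ℝ) (I : Finset (Fin n)) (k : ℕ) :
    Matrix (monos I k) (monos I k) ℝ :=
  Matrix.of fun α β => y (α.1 + β.1)

/-- The sparse localizing matrix `M_k(h y, I)`. -/
noncomputable def localizingMatrix {n : ℕ} (h : MvPolynomial (Fin n) ℝ)
    (y : (Fin n →₀ ℕ) → ℝ) (I : Finset (Fin n)) (k : ℕ) :
    Matrix (monos I k) (monos I k) ℝ :=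
  Matrix.of fun α β => rieszL y (h * monomial (α.1 + β.1) 1)

/-- The point of `ℝⁿ` with coordinates `z` on `I` and `0` elsewhere. Polynomials in the variables
`x_l`, `l ∈ I`, are evaluated at `z ∈ ℝ^I` through this point. -/
def extendZero {n : ℕ} {I : Finset (Fin n)} (z : I → ℝ) : Fin n → ℝ :=
  fun l => if h : l ∈ I then z ⟨l, h⟩ else 0

/-- The data of a sparse problem of minimizing `∑_i p_i / q_i` subject to `g_j ≥ 0`: the blocks
of variables `I_i`, the polynomials `p_i`, `q_i`, `g_j`, the radius parameter `M` of the ball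
constraints, and the sets `J_i` of constraints attached to the blocks. A constraint index is
`Sum.inl j` for `g_j` and `Sum.inr i` for the ball constraint of the block `i`. -/
structure SparseProblem (n N m : ℕ) where
  I : Fin N → Finset (Fin n)
  p : Fin N → MvPolynomial (Fin n) ℝ
  q : Fin N → MvPolynomial (Fin n) ℝ
  g : Fin m → MvPolynomial (Fin n) ℝ
  M : ℝ
  J : Fin N → Finset (Fin m ⊕ Fin N)

namespace SparseProblem

variable {n N m : ℕ} (P : SparseProblem n N m)

/-- All the constraint polynomials: the `g_j`, and `M - ∑_{l ∈ I_i} x_l²` for each block. -/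
noncomputable def con : Fin m ⊕ Fin N → MvPolynomial (Fin n) ℝ
  | Sum.inl j => P.g j
  | Sum.inr i => C P.M - ∑ l ∈ P.I i, X l ^ 2

/-- The feasible set `K`. -/
def K : Set (Fin n → ℝ) :=
  {x | ∀ j, 0 ≤ eval x (P.g j)}

/-- The set `K_i ⊆ ℝ^{I_i}` cut out by the constraints of the block `i`. -/
def blockK (i : Fin N) : Set (P.I i → ℝ) :=
  {z | ∀ c ∈ P.J i, 0 ≤ eval (extendZero z) (P.con c)}

/-- The objective function `f = ∑_i p_i / q_i`. -/
noncomputable def objective (x : Fin n → ℝ) : ℝ :=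
  ∑ i, eval x (P.p i) / eval x (P.q i)

/-- The infimum `f*` of `f` over `K`. -/
noncomputable def optVal : EReal :=
  ⨅ x ∈ P.K, (P.objective x : EReal)

/-- `x` is a global minimizer of `f` over `K`. -/
def IsGlobalMinimizer (x : Fin n → ℝ) : Prop :=
  x ∈ P.K ∧ ∀ x' ∈ P.K, P.objective x ≤ P.objective x'

/-- The running intersection property of `(I_i)`. -/
def RunningIntersection : Prop :=
  ∀ i : Fin N, 0 < (i : ℕ) → ∃ j < i, P.I i ∩ (Finset.Iio i).biUnion P.I ⊆ P.I j

/-- The half degree `r_c = ⌈deg g_c / 2⌉` of a constraint. -/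
noncomputable def halfDeg (c : Fin m ⊕ Fin N) : ℕ :=
  ((P.con c).totalDegree + 1) / 2

/-- `v_i = max_{c ∈ J_i} r_c`. -/
noncomputable def blockHalfDeg (i : Fin N) : ℕ :=
  (P.J i).sup P.halfDeg

/-- The orders `k` for which the relaxation is defined: `L_y(q_i)` only involves moments of degree
at most `2k`, and the orders `k - r_c` of the localizing matrices are nonnegative. -/
def Admissible (k : ℕ) : Prop :=
  (∀ i, (P.q i).totalDegree ≤ 2 * k) ∧ ∀ c, P.halfDeg c ≤ k

/-- Feasibility of `(y_1, …, y_N)` in the relaxation of order `k`. Only the entries of `y_i` at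
exponents supported in `I_i` matter. -/
structure IsFeasible (k : ℕ) (y : Fin N → (Fin n →₀ ℕ) → ℝ) : Prop where
  moment : ∀ i, (momentMatrix (y i) (P.I i) k).PosSemidef
  localizing : ∀ i, ∀ c ∈ P.J i,
    (localizingMatrix (P.con c) (y i) (P.I i) (k - P.halfDeg c)).PosSemidef
  normalized : ∀ i, rieszL (y i) (P.q i) = 1
  coupling : ∀ i j, i < j → (P.I i ∩ P.I j).Nonempty →
    ∀ α : Fin n →₀ ℕ, α.support ⊆ P.I i ∩ P.I j →
      α.degree + max (P.q i).totalDegree (P.q j).totalDegree ≤ 2 * k →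
      rieszL (y i) (monomial α 1 * P.q i) = rieszL (y j) (monomial α 1 * P.q j)

/-- The objective `∑_i L_{y_i}(p_i)` of the relaxation. -/
noncomputable def relaxObjective (y : Fin N → (Fin n →₀ ℕ) → ℝ) : ℝ :=
  ∑ i, rieszL (y i) (P.p i)

/-- The optimal value `f*_k` of the relaxation of order `k`. -/
noncomputable def relaxVal (k : ℕ) : EReal :=
  ⨅ (y : Fin N → (Fin n →₀ ℕ) → ℝ) (_ : P.IsFeasible k y), (P.relaxObjective y : EReal)

/-- `y` is an optimal solution of the relaxation of order `k`. -/
def IsOptimal (k : ℕ) (y : Fin N → (Fin n →₀ ℕ) → ℝ) : Prop :=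
  P.IsFeasible k y ∧ ∀ y', P.IsFeasible k y' → P.relaxObjective y ≤ P.relaxObjective y'

end SparseProblem

/-! The argument has two independent parts.

**Convergence.** A point `x` of `K` is feasible for every relaxation, through the moments of
`δ_x / q_i(x)`, so `f*_k ≤ f*`. Conversely, suppose that all `f*_k` stay below some `c < f*`, and
take feasible points of value at most `c`. The ball constraints bound the moments by multiples of
`y_i(0)`, so along an ultrafilter the normalized functionals `L_{y_i} / y_i(0)` converge to
functionals `Λ_i` on polynomials which are nonnegative on squares and on the multiples of the block
constraints by squares (`exists_limit_functionals`). The dual form of Putinar's theorem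
(`IsArchimedeanQuadraticModule.apply_nonneg`) makes `Λ_i` nonnegative on all polynomials nonnegative
on the block: a functional in the compact convex set of states which minimizes the value at a given
polynomial can be chosen extreme, and extreme states are multiplicative, hence point evaluations.
In particular `Λ_i(q_i) > 0`, which is why normalizing by `y_i(0)` instead of `L_{y_i}(q_i)` loses
nothing. By Haviland's theorem `Λ_i` is a measure `μ_i`; the coupling conditions say that the
probability measures `q_i μ_i / Λ_i(q_i)` have common marginals on the overlaps of the blocks.
The running intersection property allows gluing them, by disintegration, to one probability measure
on `K` (`exists_measure_of_running_intersection`), whose integral of `f` is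
`∑ i, Λ_i(p_i) / Λ_i(q_i) ≤ c`. This contradicts `c < f*`, also when `K` is empty.

**Extraction.** The flat extension theorem of Curto and Fialkow (`flat_extension`) turns the rank
condition into an atomic representing measure for each `y_i`: the moment matrix is the Gram matrix
of vectors on which multiplication by the variables acts by commuting symmetric operators, and the
atoms are their joint eigenvalues. The rank one conditions make all atoms of a block agree on the
overlaps, and the coupling of `L(x_l q_i)` makes the atoms of different blocks agree there, so any
choice of atoms assembles to a point of `K`. The optimal value is a sum of means of the ratios
`p_i / q_i` over the atoms, and it is at most the value of every assembled point, in particular of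
one assembled from the minimizers of the ratios; so the ratios are constant on the atoms and every
assembled point is optimal (`IsOptimal.objective_eq`). -/

/-! ### The Riesz functional and the moment and localizing matrices -/

/-- `rieszL y` as a linear map. -/
noncomputable def rieszLin {n : ℕ} (y : (Fin n →₀ ℕ) → ℝ) : MvPolynomial (Fin n) ℝ →ₗ[ℝ] ℝ :=
  (basisMonomials (Fin n) ℝ).constr ℝ y

theorem rieszLin_monomial {n : ℕ} (y : (Fin n →₀ ℕ) → ℝ) (α : Fin n →₀ ℕ) (c : ℝ) :
    rieszLin y (monomial α c) = c * y α := by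
  have h : monomial α c = c • (basisMonomials (Fin n) ℝ) α := by
    simp [smul_monomial]
  rw [h, map_smul, rieszLin, Module.Basis.constr_basis, smul_eq_mul]

theorem rieszL_eq {n : ℕ} (y : (Fin n →₀ ℕ) → ℝ) (f : MvPolynomial (Fin n) ℝ) :
    rieszL y f = rieszLin y f := by
  conv_rhs => rw [f.as_sum, map_sum]
  exact Finset.sum_congr rfl fun α _ => (rieszLin_monomial y α _).symm

theorem rieszL_congr {n : ℕ} {y y' : (Fin n →₀ ℕ) → ℝ} {f : MvPolynomial (Fin n) ℝ}
    (h : ∀ α ∈ f.support, y α = y' α) : rieszL y f = rieszL y' f :=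
  Finset.sum_congr rfl fun α hα => by rw [h α hα]

theorem rieszL_smul_left {n : ℕ} (y : (Fin n →₀ ℕ) → ℝ) (a : ℝ) (f : MvPolynomial (Fin n) ℝ) :
    rieszL (fun α => a * y α) f = a * rieszL y f := by
  simp only [rieszL, Finset.mul_sum]
  exact Finset.sum_congr rfl fun α _ => by ring

/-- The Riesz functional of the moments of the Dirac measure at `x` is the evaluation at `x`. -/
theorem rieszL_eval {n : ℕ} (x : Fin n → ℝ) (f : MvPolynomial (Fin n) ℝ) :
    rieszL (fun α => eval x (monomial α 1)) f = eval x f := by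
  conv_rhs => rw [f.as_sum, map_sum]
  exact Finset.sum_congr rfl fun α _ => by simp [eval_monomial]

theorem eval_monomial_add {n : ℕ} (x : Fin n → ℝ) (α β : Fin n →₀ ℕ) :
    eval x (monomial (α + β) (1 : ℝ)) = eval x (monomial α 1) * eval x (monomial β 1) := by
  rw [← map_mul, monomial_mul, one_mul]

theorem support_subset_monos_iff {n : ℕ} {I : Finset (Fin n)} {k : ℕ}
    {f : MvPolynomial (Fin n) ℝ} :
    f.support ⊆ monos I k ↔ f.vars ⊆ I ∧ f.totalDegree ≤ k := by
  constructor
  · intro h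
    refine ⟨fun l hl => ?_, (Finset.sup_le fun α hα => by
      simpa [Finsupp.degree_eq_sum, Finsupp.sum_fintype] using (mem_monos.1 (h hα)).2)⟩
    obtain ⟨α, hα, hl⟩ := (mem_vars_iff_mem_support l).1 hl
    exact (mem_monos.1 (h hα)).1 hl
  · rintro ⟨hv, hd⟩ α hα
    refine mem_monos.2 ⟨fun l hl => hv ((mem_vars_iff_mem_support l).2 ⟨α, hα, hl⟩), ?_⟩
    refine le_trans ?_ ((le_totalDegree hα).trans hd)
    simp [Finsupp.degree_eq_sum, Finsupp.sum_fintype]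

theorem monos_mono {n : ℕ} {I J : Finset (Fin n)} {k k' : ℕ} (hI : I ⊆ J) (hk : k ≤ k') :
    monos I k ⊆ monos J k' := fun _ h =>
  mem_monos.2 ⟨(mem_monos.1 h).1.trans hI, (mem_monos.1 h).2.trans hk⟩

theorem add_mem_monos {n : ℕ} {I : Finset (Fin n)} {k k' : ℕ} {α β : Fin n →₀ ℕ}
    (hα : α ∈ monos I k) (hβ : β ∈ monos I k') : α + β ∈ monos I (k + k') := by
  rw [mem_monos] at *
  refine ⟨Finsupp.support_add.trans (Finset.union_subset hα.1 hβ.1), ?_⟩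
  rw [map_add]
  omega

theorem monomial_support_subset_monos {n k : ℕ} {I : Finset (Fin n)} {α : Fin n →₀ ℕ} (hα : α ∈ monos I k)
    (a : ℝ) : (monomial α a).support ⊆ monos I k := fun β hβ => by
  have := Finset.mem_singleton.1 (support_monomial_subset hβ)
  exact this ▸ hα

theorem zero_mem_monos {n k : ℕ} {I : Finset (Fin n)} : (0 : Fin n →₀ ℕ) ∈ monos I k :=
  mem_monos.2 ⟨by simp, by simp⟩

theorem mul_support_subset_monos {n : ℕ} {I : Finset (Fin n)} {k k' : ℕ}
    {f g : MvPolynomial (Fin n) ℝ} (hf : f.support ⊆ monos I k) (hg : g.support ⊆ monos I k') :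
    (f * g).support ⊆ monos I (k + k') := by
  classical
  intro γ hγ
  obtain ⟨α, hα, β, hβ, rfl⟩ := Finset.mem_add.1 (support_mul f g hγ)
  exact add_mem_monos (hf hα) (hg hβ)

theorem momentMatrix_eq {n : ℕ} (y : (Fin n →₀ ℕ) → ℝ) (I : Finset (Fin n)) (k : ℕ) :
    momentMatrix y I k = localizingMatrix 1 y I k := by
  ext α β
  simp [momentMatrix, localizingMatrix, rieszL_eq, rieszLin_monomial]

theorem localizingMatrix_quadratic_form {n : ℕ} (g : MvPolynomial (Fin n) ℝ)
    (y : (Fin n →₀ ℕ) → ℝ) (I : Finset (Fin n)) (k : ℕ) (c : monos I k → ℝ) :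
    c ⬝ᵥ (localizingMatrix g y I k).mulVec c =
      rieszL y ((∑ α, monomial α.1 (c α)) * (∑ α, monomial α.1 (c α)) * g) := by
  rw [rieszL_eq, Finset.sum_mul_sum, Finset.sum_mul, map_sum]
  simp only [dotProduct, Matrix.mulVec, Finset.mul_sum, Finset.sum_mul, map_sum]
  refine Finset.sum_congr rfl fun α _ => Finset.sum_congr rfl fun β _ => ?_
  have h : monomial α.1 (c α) * monomial β.1 (c β) * g
      = (c α * c β) • (g * monomial (α.1 + β.1) 1) := by
    rw [monomial_mul, mul_comm _ g, ← mul_smul_comm, smul_monomial, smul_eq_mul, mul_one]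
  rw [h, map_smul, smul_eq_mul, ← rieszL_eq]
  simp only [localizingMatrix, Matrix.of_apply]
  ring

theorem localizingMatrix_posSemidef_iff {n : ℕ} (g : MvPolynomial (Fin n) ℝ)
    (y : (Fin n →₀ ℕ) → ℝ) (I : Finset (Fin n)) (k : ℕ) :
    (localizingMatrix g y I k).PosSemidef ↔
      ∀ h : MvPolynomial (Fin n) ℝ, h.support ⊆ monos I k → 0 ≤ rieszL y (h * h * g) := by
  rw [Matrix.posSemidef_iff_dotProduct_mulVec]
  constructor
  · rintro ⟨-, H⟩ h hh
    have := H fun α => h.coeff α.1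
    rw [star_trivial, localizingMatrix_quadratic_form] at this
    have hsum : ∑ α : monos I k, monomial α.1 (h.coeff α.1) = h := by
      conv_rhs => rw [h.as_sum]
      rw [Finset.sum_coe_sort (monos I k) (fun α => monomial α (h.coeff α))]
      refine (Finset.sum_subset hh fun α _ hα => ?_).symm
      rw [notMem_support_iff.1 hα, map_zero]
    rwa [hsum] at this
  · intro H
    refine ⟨?_, fun c => ?_⟩
    · ext α β
      simp [localizingMatrix, add_comm]
    · rw [star_trivial, localizingMatrix_quadratic_form]
      refine H _ fun α hα => ?_
      classical
      obtain ⟨β, -, hβ⟩ := Finset.mem_biUnion.1 (support_sum hα)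
      have := support_monomial_subset hβ
      rw [Finset.mem_singleton] at this
      exact this ▸ β.2

theorem momentMatrix_posSemidef_iff {n : ℕ} (y : (Fin n →₀ ℕ) → ℝ) (I : Finset (Fin n)) (k : ℕ) :
    (momentMatrix y I k).PosSemidef ↔
      ∀ h : MvPolynomial (Fin n) ℝ, h.support ⊆ monos I k → 0 ≤ rieszL y (h * h) := by
  rw [momentMatrix_eq, localizingMatrix_posSemidef_iff]
  simp only [mul_one]

/-- The `2 × 2` minors of a moment matrix of rank one vanish. -/
theorem mul_eq_mul_of_momentMatrix_rank_eq_one {n : ℕ} {y : (Fin n →₀ ℕ) → ℝ}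
    {I : Finset (Fin n)} {k : ℕ} (h : (momentMatrix y I k).rank = 1) {α β : Fin n →₀ ℕ}
    (hα : α ∈ monos I k) (hβ : β ∈ monos I k) :
    y (α + α) * y (β + β) = y (α + β) * y (α + β) := by
  rw [Matrix.rank_eq_finrank_span_cols] at h
  obtain ⟨v, -, hv⟩ := finrank_eq_one_iff'.1 h
  have key : ∀ γ : monos I k, ∃ c : ℝ, ∀ δ : monos I k, y (δ.1 + γ.1) = c * v.1 δ := by
    intro γ
    obtain ⟨c, hc⟩ := hv ⟨_, Submodule.subset_span ⟨γ, rfl⟩⟩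
    refine ⟨c, fun δ => ?_⟩
    have := congrFun (congrArg Subtype.val hc) δ
    exact this.symm
  obtain ⟨a, ha⟩ := key ⟨α, hα⟩
  obtain ⟨b, hb⟩ := key ⟨β, hβ⟩
  have h1 := ha ⟨α, hα⟩
  have h2 := hb ⟨β, hβ⟩
  have h3 := ha ⟨β, hβ⟩
  have h4 := hb ⟨α, hα⟩
  simp only at h1 h2 h3 h4
  calc y (α + α) * y (β + β) = y (β + α) * y (α + β) := by rw [h1, h2, h3, h4]; ring
    _ = _ := by rw [add_comm β α]

/-! ### Polynomials in a block of variables -/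

theorem eval_eq_of_eqOn_vars {n : ℕ} {f : MvPolynomial (Fin n) ℝ} {I : Finset (Fin n)}
    (hf : f.vars ⊆ I) {x x' : Fin n → ℝ} (h : ∀ l ∈ I, x l = x' l) : eval x f = eval x' f :=
  eval₂Hom_congr' rfl (fun l hl _ => h l (hf hl)) rfl

theorem eval_extendZero_restrict {n : ℕ} {f : MvPolynomial (Fin n) ℝ} {I : Finset (Fin n)}
    (hf : f.vars ⊆ I) (x : Fin n → ℝ) : eval (extendZero (I.restrict x)) f = eval x f :=
  eval_eq_of_eqOn_vars hf fun l hl => by simp [extendZero, hl]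

namespace SparseProblem

variable {n N m : ℕ} {P : SparseProblem n N m}

theorem con_vars (hJ : ∀ c, ∃! i, c ∈ P.J i) (hJball : ∀ i, Sum.inr i ∈ P.J i)
    (hg : ∀ i j, Sum.inl j ∈ P.J i → (P.g j).vars ⊆ P.I i) {i : Fin N} {c : Fin m ⊕ Fin N}
    (hc : c ∈ P.J i) : (P.con c).vars ⊆ P.I i := by
  cases c with
  | inl j => exact hg i j hc
  | inr i' =>
    obtain rfl : i' = i := (hJ _).unique (hJball i') hc
    classical
    refine (vars_sub_subset _).trans (Finset.union_subset (by simp) ?_)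
    refine (vars_sum_subset _ _).trans (Finset.biUnion_subset.2 fun l hl => ?_)
    refine (vars_pow _ _).trans ?_
    simpa [vars_X] using hl

theorem restrict_mem_blockK (hcv : ∀ i, ∀ c ∈ P.J i, (P.con c).vars ⊆ P.I i) {i : Fin N}
    {x : Fin n → ℝ} : (P.I i).restrict x ∈ P.blockK i ↔ ∀ c ∈ P.J i, 0 ≤ eval x (P.con c) := by
  refine forall₂_congr fun c hc => ?_
  rw [eval_extendZero_restrict (hcv i c hc)]

end SparseProblem

/-! ### Flat extensions of moment matrices -/

section

open scoped InnerProductSpace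

/-- The rank of the Gram matrix of a finite family of vectors is the dimension of its span. -/
theorem rank_eq_finrank_span_of_gram {ι V : Type*} [Fintype ι] [DecidableEq ι]
    [NormedAddCommGroup V] [InnerProductSpace ℝ V] (b : ι → V) (G : Matrix ι ι ℝ)
    (hG : ∀ i j, ⟪b i, b j⟫_ℝ = G i j) :
    G.rank = Module.finrank ℝ (Submodule.span ℝ (Set.range b)) := by
  set F : (ι → ℝ) →ₗ[ℝ] V := Fintype.linearCombination ℝ b with hF
  have hmul : ∀ x i, (G.mulVec x) i = ⟪b i, F x⟫_ℝ := by
    intro x i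
    simp only [hF, Fintype.linearCombination_apply, inner_sum, inner_smul_right, hG,
      Matrix.mulVec, dotProduct]
    exact Finset.sum_congr rfl fun j _ => mul_comm _ _
  have hker : LinearMap.ker G.mulVecLin = LinearMap.ker F := by
    ext x
    simp only [LinearMap.mem_ker, Matrix.mulVecLin_apply]
    constructor
    · intro h
      have h2 : ⟪F x, F x⟫_ℝ = 0 := by
        conv_lhs => enter [2]; rw [hF, Fintype.linearCombination_apply]
        rw [sum_inner]
        refine Finset.sum_eq_zero fun i _ => ?_
        rw [inner_smul_left, ← hmul, h, Pi.zero_apply, mul_zero]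
      exact inner_self_eq_zero.1 h2
    · intro h
      ext i
      rw [hmul, h, inner_zero_right, Pi.zero_apply]
  have h1 := LinearMap.finrank_range_add_finrank_ker G.mulVecLin
  have h2 := LinearMap.finrank_range_add_finrank_ker F
  rw [hker] at h1
  rw [hF, Fintype.range_linearCombination, ← hF] at h2
  rw [Matrix.rank]
  omega

/-- A positive semidefinite moment matrix is the Gram matrix of a spanning family of vectors. -/
theorem exists_gram_of_momentMatrix_posSemidef {n : ℕ} {y : (Fin n →₀ ℕ) → ℝ}
    {I : Finset (Fin n)} {k : ℕ} (h : (momentMatrix y I k).PosSemidef) :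
    ∃ (d : ℕ) (V : Submodule ℝ (EuclideanSpace ℝ (Fin d))) (b : (Fin n →₀ ℕ) → V),
      (∀ α ∈ monos I k, ∀ β ∈ monos I k, ⟪b α, b β⟫_ℝ = y (α + β)) ∧
      Submodule.span ℝ (b '' monos I k) = ⊤ := by
  classical
  obtain ⟨d, v, hv⟩ := Matrix.posSemidef_iff_eq_sum_vecMulVec.1 h
  let e : monos I k → EuclideanSpace ℝ (Fin d) := fun α => WithLp.toLp 2 fun s => v s α
  let V := Submodule.span ℝ (Set.range e)
  let b : (Fin n →₀ ℕ) → V := fun α =>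
    if hα : α ∈ monos I k then ⟨e ⟨α, hα⟩, Submodule.subset_span ⟨_, rfl⟩⟩ else 0
  have hb : ∀ α : monos I k, (b α.1 : EuclideanSpace ℝ (Fin d)) = e α := fun α => by
    simp [b, α.2]
  refine ⟨d, V, b, fun α hα β hβ => ?_, ?_⟩
  · rw [Submodule.coe_inner, hb ⟨α, hα⟩, hb ⟨β, hβ⟩]
    have := congrFun (congrFun hv ⟨α, hα⟩) ⟨β, hβ⟩
    simp only [momentMatrix, Matrix.of_apply, Matrix.sum_apply, Matrix.vecMulVec_apply,
      star_trivial] at this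
    rw [this, PiLp.inner_apply]
    exact Finset.sum_congr rfl fun s _ => by simp [e, mul_comm]
  · refine Submodule.map_injective_of_injective V.injective_subtype ?_
    rw [Submodule.map_span, Submodule.map_top, Submodule.range_subtype]
    congr 1
    ext x
    constructor
    · rintro ⟨_, ⟨α, hα, rfl⟩, rfl⟩
      exact ⟨⟨α, hα⟩, (hb ⟨α, hα⟩).symm⟩
    · rintro ⟨α, rfl⟩
      exact ⟨_, ⟨α.1, α.2, rfl⟩, hb α⟩

theorem eq_of_forall_inner_eq_of_span_eq_top {V : Type*} [NormedAddCommGroup V]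
    [InnerProductSpace ℝ V] {S : Set V} (hS : Submodule.span ℝ S = ⊤) {v w : V}
    (h : ∀ s ∈ S, ⟪s, v⟫_ℝ = ⟪s, w⟫_ℝ) : v = w := by
  refine ext_inner_right ℝ fun u => ?_
  have := LinearMap.ext_on (f := innerₛₗ ℝ v) (g := innerₛₗ ℝ w) hS fun s hs => by
    simpa [real_inner_comm] using h s hs
  simpa using congrArg (fun f => f u) this

section Multiplication

variable {n : ℕ} {V : Type*} [NormedAddCommGroup V] [InnerProductSpace ℝ V]
  {y : (Fin n →₀ ℕ) → ℝ} {I : Finset (Fin n)} {k : ℕ} {b : (Fin n →₀ ℕ) → V}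

theorem add_single_mem_monos {l : Fin n} (hl : l ∈ I) {α : Fin n →₀ ℕ} (hα : α ∈ monos I k) :
    α + Finsupp.single l 1 ∈ monos I (k + 1) := by
  refine add_mem_monos hα (mem_monos.2 ⟨?_, by simp⟩)
  exact Finsupp.support_single_subset.trans (by simpa using hl)

/-- If the monomials of degree at most `k` already span the whole space, then multiplication by a
variable descends from polynomials to vectors: by symmetry of the moments, a combination of the
`b α` which vanishes is still zero after shifting every exponent. -/
theorem exists_multiplication_operator
    (hb : ∀ α ∈ monos I (k + 1), ∀ β ∈ monos I (k + 1), ⟪b α, b β⟫_ℝ = y (α + β))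
    (hspan : Submodule.span ℝ (b '' monos I k) = ⊤) {l : Fin n} (hl : l ∈ I) :
    ∃ T : V →ₗ[ℝ] V, ∀ α ∈ monos I k, T (b α) = b (α + Finsupp.single l 1) := by
  have hsub : monos I k ⊆ monos I (k + 1) := monos_mono le_rfl (Nat.le_succ k)
  set Φ : (monos I k →₀ ℝ) →ₗ[ℝ] V := Finsupp.linearCombination ℝ fun α => b α.1 with hΦ
  set Ψ : (monos I k →₀ ℝ) →ₗ[ℝ] V :=
    Finsupp.linearCombination ℝ fun α => b (α.1 + Finsupp.single l 1) with hΨ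
  have hrange : LinearMap.range Φ = ⊤ := by
    rw [hΦ, Finsupp.range_linearCombination, ← hspan]
    congr 1
    ext v
    simp
  have hadj : ∀ β ∈ monos I k, ∀ c, ⟪b β, Ψ c⟫_ℝ = ⟪b (β + Finsupp.single l 1), Φ c⟫_ℝ := by
    intro β hβ c
    have : innerₛₗ ℝ (b β) ∘ₗ Ψ = innerₛₗ ℝ (b (β + Finsupp.single l 1)) ∘ₗ Φ := by
      refine Finsupp.lhom_ext' fun α => LinearMap.ext_ring ?_
      simp only [hΦ, hΨ, LinearMap.comp_apply, Finsupp.lsingle_apply,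
        Finsupp.linearCombination_single, one_smul, innerₛₗ_apply_apply]
      rw [hb _ (hsub hβ) _ (add_single_mem_monos hl α.2),
        hb _ (add_single_mem_monos hl hβ) _ (hsub α.2)]
      congr 1
      abel
    exact congrArg (fun f => f c) this
  have hker : ∀ c, Φ c = 0 → Ψ c = 0 := by
    intro c hc
    refine eq_of_forall_inner_eq_of_span_eq_top hspan ?_
    rintro _ ⟨β, hβ, rfl⟩
    rw [hadj β hβ, hc, inner_zero_right, inner_zero_right]
  obtain ⟨s, hs⟩ := Φ.exists_rightInverse_of_surjective hrange
  refine ⟨Ψ ∘ₗ s, fun α hα => ?_⟩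
  have h1 : Φ (Finsupp.single ⟨α, hα⟩ 1) = b α := by simp [hΦ]
  have h2 : Ψ (Finsupp.single ⟨α, hα⟩ 1) = b (α + Finsupp.single l 1) := by simp [hΨ]
  have h3 : Φ (s (b α) - Finsupp.single ⟨α, hα⟩ 1) = 0 := by
    rw [map_sub, h1, ← LinearMap.comp_apply, hs, LinearMap.id_apply, sub_self]
  have h4 := hker _ h3
  rw [map_sub, h2] at h4
  exact sub_eq_zero.1 h4

theorem multiplication_operator_isSymmetric
    (hb : ∀ α ∈ monos I (k + 1), ∀ β ∈ monos I (k + 1), ⟪b α, b β⟫_ℝ = y (α + β))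
    (hspan : Submodule.span ℝ (b '' monos I k) = ⊤) {l : Fin n} (hl : l ∈ I) {T : V →ₗ[ℝ] V}
    (hT : ∀ α ∈ monos I k, T (b α) = b (α + Finsupp.single l 1)) : T.IsSymmetric := by
  have hsub : monos I k ⊆ monos I (k + 1) := monos_mono le_rfl (Nat.le_succ k)
  have h1 : ∀ β ∈ monos I k, ∀ v, ⟪T (b β), v⟫_ℝ = ⟪b β, T v⟫_ℝ := by
    intro β hβ v
    have := LinearMap.ext_on (f := innerₛₗ ℝ (T (b β))) (g := innerₛₗ ℝ (b β) ∘ₗ T) hspan (by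
      rintro _ ⟨α, hα, rfl⟩
      simp only [LinearMap.comp_apply, innerₛₗ_apply_apply]
      rw [hT α hα, hT β hβ, hb _ (add_single_mem_monos hl hβ) _ (hsub hα),
        hb _ (hsub hβ) _ (add_single_mem_monos hl hα)]
      congr 1
      abel)
    exact congrArg (fun f => f v) this
  intro v w
  have := LinearMap.ext_on (f := innerₛₗ ℝ w ∘ₗ T) (g := innerₛₗ ℝ (T w)) hspan (by
    rintro _ ⟨β, hβ, rfl⟩
    simp only [LinearMap.comp_apply, innerₛₗ_apply_apply]
    rw [real_inner_comm, h1 β hβ, real_inner_comm])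
  have := congrArg (fun f => f v) this
  simp only [LinearMap.comp_apply, innerₛₗ_apply_apply] at this
  rw [real_inner_comm, this, real_inner_comm]

theorem multiplication_operators_commute
    (hb : ∀ α ∈ monos I (k + 1), ∀ β ∈ monos I (k + 1), ⟪b α, b β⟫_ℝ = y (α + β))
    (hspan : Submodule.span ℝ (b '' monos I k) = ⊤) {l l' : Fin n} (hl : l ∈ I) (hl' : l' ∈ I)
    {T T' : V →ₗ[ℝ] V} (hT : ∀ α ∈ monos I k, T (b α) = b (α + Finsupp.single l 1))
    (hT' : ∀ α ∈ monos I k, T' (b α) = b (α + Finsupp.single l' 1)) : Commute T T' := by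
  refine LinearMap.ext_on hspan ?_
  rintro _ ⟨α, hα, rfl⟩
  refine eq_of_forall_inner_eq_of_span_eq_top hspan ?_
  rintro _ ⟨β, hβ, rfl⟩
  rw [Module.End.mul_apply, Module.End.mul_apply,
    ← multiplication_operator_isSymmetric hb hspan hl hT (b β) (T' (b α)),
    ← multiplication_operator_isSymmetric hb hspan hl' hT' (b β) (T (b α)), hT α hα, hT β hβ, hT' α hα, hT' β hβ,
    hb _ (add_single_mem_monos hl hβ) _ (add_single_mem_monos hl' hα),
    hb _ (add_single_mem_monos hl' hβ) _ (add_single_mem_monos hl hα)]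
  congr 1
  abel

/-- A flat Gram representation of the moments is diagonalized by the joint eigenvectors of the
multiplication operators: the vector `b α` is a combination of orthogonal vectors `u z`, one for
each joint eigenvalue `z`, with coefficients `z^α`. -/
theorem exists_eigenvector_expansion [FiniteDimensional ℝ V]
    (hb : ∀ α ∈ monos I k, ∀ β ∈ monos I k, ⟪b α, b β⟫_ℝ = y (α + β))
    (hspan : I.Nonempty → ∃ k', k = k' + 1 ∧ Submodule.span ℝ (b '' monos I k') = ⊤) :
    ∃ (Δ : Finset (I → ℝ)) (u : (I → ℝ) → V), (∀ z ∈ Δ, u z ≠ 0) ∧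
      (∀ z z', z ≠ z' → ⟪u z, u z'⟫_ℝ = 0) ∧
      ∀ α ∈ monos I k, b α = ∑ z ∈ Δ, eval (extendZero z) (monomial α 1) • u z := by
  classical
  have hop : ∀ l : I, ∃ T : V →ₗ[ℝ] V,
      ∀ α ∈ monos I (k - 1), T (b α) = b (α + Finsupp.single l.1 1) := by
    intro l
    obtain ⟨k', rfl, hs⟩ := hspan ⟨l.1, l.2⟩
    exact exists_multiplication_operator hb hs l.2
  choose T hT using hop
  have hsymm : ∀ l, (T l).IsSymmetric := by
    intro l
    obtain ⟨k', rfl, hs⟩ := hspan ⟨l.1, l.2⟩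
    exact multiplication_operator_isSymmetric hb hs l.2 (hT l)
  have hcomm : Pairwise (Function.onFun Commute T) := by
    intro l l' _
    obtain ⟨k', rfl, hs⟩ := hspan ⟨l.1, l.2⟩
    exact multiplication_operators_commute hb hs l.2 l'.2 (hT l) (hT l')
  have htop := LinearMap.IsSymmetric.iSup_iInf_eq_top_of_commute hsymm hcomm
  have hmem : b 0 ∈ ⨆ χ : I → ℝ, ⨅ l, Module.End.eigenspace (T l) (χ l) := htop ▸ trivial
  obtain ⟨u, hu, hsum⟩ := (Submodule.mem_iSup_iff_exists_finsupp _ _).1 hmem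
  have hT' : ∀ l z, T l (u z) = z l • u z := fun l z =>
    Module.End.mem_eigenspace_iff.1 ((Submodule.mem_iInf _).1 (hu z) l)
  refine ⟨u.support, u, fun z hz => Finsupp.mem_support_iff.1 hz, fun z z' hzz => ?_, ?_⟩
  · exact LinearMap.IsSymmetric.orthogonalFamily_iInf_eigenspaces hsymm hzz
      ⟨u z, hu z⟩ ⟨u z', hu z'⟩
  · have key : ∀ d : ℕ, ∀ α ∈ monos I k, α.degree = d →
        b α = ∑ z ∈ u.support, eval (extendZero z) (monomial α 1) • u z := by
      intro d
      induction d with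
      | zero =>
        intro α _ hd
        rw [(Finsupp.degree_eq_zero_iff α).1 hd, ← hsum, Finsupp.sum]
        simp
      | succ d ih =>
        intro α hα hd
        obtain ⟨hαI, hαk⟩ := mem_monos.1 hα
        obtain ⟨l, hl⟩ : α.support.Nonempty := by
          rw [Finsupp.support_nonempty_iff]
          rintro rfl
          simp at hd
        have hαl : α - Finsupp.single l 1 + Finsupp.single l 1 = α :=
          Finsupp.sub_add_single_one_cancel (Finsupp.mem_support_iff.1 hl)
        set β := α - Finsupp.single l 1
        have hβd : β.degree = d := by
          have := congrArg Finsupp.degree hαl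
          rw [map_add, Finsupp.degree_single] at this
          omega
        have hβ : β ∈ monos I (k - 1) := by
          refine mem_monos.2 ⟨?_, by omega⟩
          refine (Finsupp.support_mono ?_).trans hαI
          exact tsub_le_self
        rw [← hαl, ← hT ⟨l, hαI hl⟩ β hβ, ih β (monos_mono le_rfl (Nat.sub_le _ _) hβ) hβd, map_sum]
        refine Finset.sum_congr rfl fun z _ => ?_
        rw [map_smul, hT', smul_smul]
        congr 1
        rw [eval_monomial_add]
        congr 1
        simp [eval_monomial, extendZero, hαI hl]
    exact fun α hα => key _ α hα rfl

end Multiplication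

theorem inner_sum_smul_of_orthogonal {ι V : Type*} [NormedAddCommGroup V] [InnerProductSpace ℝ V]
    {u : ι → V} (horth : ∀ i j, i ≠ j → ⟪u i, u j⟫_ℝ = 0) {s : Finset ι} {i : ι} (hi : i ∈ s)
    (c : ι → ℝ) : ⟪u i, ∑ j ∈ s, c j • u j⟫_ℝ = c i * ‖u i‖ ^ 2 := by
  rw [inner_sum, Finset.sum_eq_single_of_mem i hi, real_inner_smul_right,
    real_inner_self_eq_norm_sq]
  intro j _ hne
  rw [real_inner_smul_right, horth i j hne.symm, mul_zero]

theorem exists_add_of_mem_monos_two_mul {n : ℕ} {I : Finset (Fin n)} {k : ℕ} {α : Fin n →₀ ℕ}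
    (hα : α ∈ monos I (2 * k)) : ∃ β ∈ monos I k, ∃ γ ∈ monos I k, α = β + γ := by
  obtain ⟨hI, hd⟩ := mem_monos.1 hα
  obtain ⟨β, hβ, hβd⟩ := Finsupp.exists_le_degree_eq α (min k α.degree) (min_le_right _ _)
  obtain ⟨γ, rfl⟩ := le_iff_exists_add.1 hβ
  rw [map_add] at hd hβd
  refine ⟨β, mem_monos.2 ⟨(Finsupp.support_mono hβ).trans hI, by omega⟩, γ,
    mem_monos.2 ⟨(Finsupp.support_mono (by simp)).trans hI, by omega⟩, rfl⟩

/-- **Flat extension theorem** of Curto and Fialkow: if the moment matrix of order `k` is positive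
semidefinite and has the same rank as one of smaller order `j`, then the moments are those of a
measure with as many atoms as the rank. The atoms can be interpolated in degree `j`. -/
theorem flat_extension {n : ℕ} {y : (Fin n →₀ ℕ) → ℝ} {I : Finset (Fin n)} {k j : ℕ}
    (hpsd : (momentMatrix y I k).PosSemidef) (hjk : j ≤ k) (hI : I.Nonempty → j < k)
    (hrank : (momentMatrix y I k).rank = (momentMatrix y I j).rank) :
    ∃ (Δ : Finset (I → ℝ)) (w : (I → ℝ) → ℝ), Δ.card = (momentMatrix y I k).rank ∧
      (∀ z ∈ Δ, 0 < w z) ∧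
      (∀ α ∈ monos I (2 * k), y α = ∑ z ∈ Δ, w z * eval (extendZero z) (monomial α 1)) ∧
      ∀ z ∈ Δ, ∃ h : MvPolynomial (Fin n) ℝ, h.support ⊆ monos I j ∧
        ∀ z' ∈ Δ, eval (extendZero z') h = if z' = z then 1 else 0 := by
  classical
  obtain ⟨d, V, b, hb, hbspan⟩ := exists_gram_of_momentMatrix_posSemidef hpsd
  have hsub : ∀ {i}, i ≤ k → monos I i ⊆ monos I k := fun hi => monos_mono le_rfl hi
  have hrk : ∀ i ≤ k, (momentMatrix y I i).rank =
      Module.finrank ℝ (Submodule.span ℝ (b '' monos I i)) := by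
    intro i hi
    rw [rank_eq_finrank_span_of_gram (fun α : monos I i => b α.1) (momentMatrix y I i)
      fun α β => hb _ (hsub hi α.2) _ (hsub hi β.2)]
    have : (Set.range fun α : monos I i => b α.1) = b '' monos I i := by
      ext v
      simp
    rw [this]
  have hjspan : Submodule.span ℝ (b '' monos I j) = ⊤ := by
    refine Submodule.eq_top_of_finrank_eq ?_
    rw [← hrk j hjk, ← hrank, hrk k le_rfl, hbspan, finrank_top]
  obtain ⟨Δ, u, hu0, horth, hexp⟩ := exists_eigenvector_expansion hb fun hne => by
    have := hI hne
    refine ⟨k - 1, by omega, eq_top_iff.2 (hjspan ▸ Submodule.span_mono ?_)⟩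
    exact Set.image_mono (monos_mono le_rfl (by omega))
  have horth' : ∀ z ∈ Δ, ∀ c : (I → ℝ) → ℝ, ⟪u z, ∑ z' ∈ Δ, c z' • u z'⟫_ℝ = c z * ‖u z‖ ^ 2 :=
    fun z hz c => inner_sum_smul_of_orthogonal horth hz c
  have hli : LinearIndependent ℝ fun z : Δ => u z.1 :=
    linearIndependent_of_ne_zero_of_inner_eq_zero (𝕜 := ℝ) (fun z => hu0 z.1 z.2)
      fun z z' hne => horth _ _ fun h => hne (Subtype.ext h)
  have huspan : Submodule.span ℝ (Set.range fun z : Δ => u z.1) = ⊤ := by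
    rw [eq_top_iff, ← hbspan, Submodule.span_le]
    rintro _ ⟨α, hα, rfl⟩
    rw [hexp α hα]
    exact Submodule.sum_mem _ fun z hz => Submodule.smul_mem _ _ (Submodule.subset_span ⟨⟨z, hz⟩, rfl⟩)
  refine ⟨Δ, fun z => ‖u z‖ ^ 2, ?_, fun z hz => ?_, fun α hα => ?_, fun z hz => ?_⟩
  · rw [hrk k le_rfl, hbspan, ← huspan, finrank_span_eq_card hli, Fintype.card_coe]
  · exact pow_pos (norm_pos_iff.2 (hu0 z hz)) 2
  · obtain ⟨β, hβ, γ, hγ, rfl⟩ := exists_add_of_mem_monos_two_mul hα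
    rw [← hb β hβ γ hγ, hexp β hβ, sum_inner]
    refine Finset.sum_congr rfl fun z hz => ?_
    rw [inner_smul_left, hexp γ hγ, horth' z hz, eval_monomial_add, RCLike.conj_to_real]
    ring
  · -- The vector `u z` is the image of a polynomial of degree at most `j`; pairing it with the
    -- vectors `u z'` reads off the values of this polynomial at the atoms.
    have hall : ∀ v : V, ∃ h : MvPolynomial (Fin n) ℝ, h.support ⊆ monos I j ∧
        v = ∑ z ∈ Δ, eval (extendZero z) h • u z := by
      intro v
      have hv : v ∈ Submodule.span ℝ (b '' monos I j) := hjspan ▸ trivial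
      induction hv using Submodule.span_induction with
      | mem v hv =>
        obtain ⟨α, hα, rfl⟩ := hv
        refine ⟨monomial α 1, fun β hβ => ?_, hexp α (hsub hjk hα)⟩
        have := Finset.mem_singleton.1 (support_monomial_subset hβ)
        exact this ▸ hα
      | zero => exact ⟨0, by simp, by simp⟩
      | add v v' _ _ ih ih' =>
        obtain ⟨h, hs, rfl⟩ := ih
        obtain ⟨h', hs', rfl⟩ := ih'
        refine ⟨h + h', support_add.trans (Finset.union_subset hs hs'), ?_⟩
        simp only [map_add, add_smul, Finset.sum_add_distrib]
      | smul a v _ ih =>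
        obtain ⟨h, hs, rfl⟩ := ih
        refine ⟨a • h, support_smul.trans hs, ?_⟩
        simp only [smul_eval, mul_smul, Finset.smul_sum]
    obtain ⟨h, hs, hh⟩ := hall (u z)
    refine ⟨h, hs, fun z' hz' => ?_⟩
    have h1 := horth' z' hz' fun z => eval (extendZero z) h
    rw [← hh] at h1
    have h2 : ‖u z'‖ ^ 2 ≠ 0 := pow_ne_zero _ (norm_ne_zero_iff.2 (hu0 z' hz'))
    split_ifs with heq
    · subst heq
      rw [real_inner_self_eq_norm_sq] at h1
      exact (mul_right_cancel₀ h2 (by rw [one_mul]; exact h1)).symm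
    · rw [horth z' z heq] at h1
      exact (mul_eq_zero.1 h1.symm).resolve_right h2

end

/-! ### Functionals nonnegative on an Archimedean quadratic module -/

/-- `Q` is an Archimedean quadratic module of the real algebra `A`: it contains `1`, is closed
under addition and under multiplication by squares, and every element of `A` is bounded above by
a constant modulo `Q`. -/
structure IsArchimedeanQuadraticModule {A : Type*} [CommRing A] [Algebra ℝ A] (Q : Set A) :
    Prop where
  one_mem : (1 : A) ∈ Q
  add_mem : ∀ {a b}, a ∈ Q → b ∈ Q → a + b ∈ Q
  sq_mul_mem : ∀ h {a}, a ∈ Q → h * h * a ∈ Q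
  exists_sub_mem : ∀ a, ∃ r : ℝ, algebraMap ℝ A r - a ∈ Q

/-- A bounded nonnegative sequence with `r i ^ 2 ≤ r 0 * r (2 * i)` cannot grow at the first step,
since otherwise it would grow geometrically along the powers of two. -/
theorem le_of_sq_le_mul_of_bounded {r : ℕ → ℝ} (h0 : ∀ i, 0 ≤ r i)
    (hsq : ∀ i, r i ^ 2 ≤ r 0 * r (2 * i)) {c : ℝ} (hc : ∀ i, r i ≤ c) : r 1 ≤ r 0 := by
  by_contra! hlt
  rcases (h0 0).eq_or_lt with h | hpos
  · have := hsq 1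
    rw [← h, zero_mul] at this
    nlinarith [h0 0]
  · have hρ : 1 < r 1 / r 0 := (one_lt_div hpos).2 hlt
    have key : ∀ j : ℕ, r 0 * (r 1 / r 0) ^ 2 ^ j ≤ r (2 ^ j) := by
      intro j
      induction j with
      | zero => simp [mul_div_cancel₀ _ hpos.ne']
      | succ j ih =>
        have h1 := hsq (2 ^ j)
        rw [← pow_succ'] at h1
        have h2 : (r 0 * (r 1 / r 0) ^ 2 ^ j) ^ 2 ≤ r (2 ^ j) ^ 2 :=
          pow_le_pow_left₀ (by positivity) ih 2
        have h3 : (r 0 * (r 1 / r 0) ^ 2 ^ j) ^ 2 = r 0 * (r 0 * (r 1 / r 0) ^ 2 ^ (j + 1)) := by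
          rw [pow_succ 2 j, pow_mul]
          ring
        rw [h3] at h2
        exact le_of_mul_le_mul_left (h2.trans h1) hpos
    have htend : Filter.Tendsto (fun j : ℕ => r 0 * (r 1 / r 0) ^ 2 ^ j) Filter.atTop
        Filter.atTop :=
      ((tendsto_pow_atTop_atTop_of_one_lt hρ).comp
        (tendsto_pow_atTop_atTop_of_one_lt one_lt_two)).const_mul_atTop hpos
    obtain ⟨j, hj⟩ := (htend.eventually_gt_atTop c).exists
    exact absurd ((key j).trans (hc _)) (not_le.2 hj)

namespace IsArchimedeanQuadraticModule

variable {A : Type*} [CommRing A] [Algebra ℝ A] {Q : Set A}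

theorem smul_mem (hQ : IsArchimedeanQuadraticModule Q) {c : ℝ} (hc : 0 ≤ c) {a : A} (ha : a ∈ Q) :
    c • a ∈ Q := by
  have := hQ.sq_mul_mem (algebraMap ℝ A √c) ha
  rwa [← map_mul, Real.mul_self_sqrt hc, ← Algebra.smul_def] at this

theorem algebraMap_mem (hQ : IsArchimedeanQuadraticModule Q) {c : ℝ} (hc : 0 ≤ c) :
    algebraMap ℝ A c ∈ Q := by
  rw [Algebra.algebraMap_eq_smul_one]
  exact hQ.smul_mem hc hQ.one_mem

theorem sq_mem (hQ : IsArchimedeanQuadraticModule Q) (h : A) : h * h ∈ Q := by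
  simpa using hQ.sq_mul_mem h hQ.one_mem

theorem exists_pos_sub_mem (hQ : IsArchimedeanQuadraticModule Q) (a : A) (b : ℝ) :
    ∃ r : ℝ, 0 < r ∧ b < r ∧ algebraMap ℝ A r - a ∈ Q := by
  obtain ⟨r, hr⟩ := hQ.exists_sub_mem a
  refine ⟨|r| + |b| + 1, by positivity, by linarith [le_abs_self b, abs_nonneg r], ?_⟩
  have := hQ.add_mem hr (hQ.algebraMap_mem (c := |r| + |b| + 1 - r)
    (by linarith [le_abs_self r, abs_nonneg b]))
  rwa [sub_add_eq_add_sub, ← map_add, add_sub_cancel] at this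

theorem pow_two_mul_mul_mem (hQ : IsArchimedeanQuadraticModule Q) (a : A) (i : ℕ) {q : A}
    (hq : q ∈ Q) : a ^ (2 * i) * q ∈ Q := by
  rw [two_mul, pow_add]
  exact hQ.sq_mul_mem _ hq

/-- The Cauchy-Schwarz inequality for the form `(h, h') ↦ L (h * h' * q)`. -/
theorem apply_mul_sq_le (hQ : IsArchimedeanQuadraticModule Q) {L : A →ₗ[ℝ] ℝ}
    (hL : ∀ q ∈ Q, 0 ≤ L q) {q : A} (hq : q ∈ Q) (h : A) :
    L (h * q) ^ 2 ≤ L q * L (h * h * q) := by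
  have key : ∀ t : ℝ, 0 ≤ L q * (t * t) + 2 * L (h * q) * t + L (h * h * q) := by
    intro t
    have := hL _ (hQ.sq_mul_mem (algebraMap ℝ A t + h) hq)
    have he : (algebraMap ℝ A t + h) * (algebraMap ℝ A t + h) * q
        = (t * t) • q + (2 * t) • (h * q) + h * h * q := by
      simp only [Algebra.smul_def, map_mul, map_ofNat]
      ring
    rw [he, map_add, map_add, map_smul, map_smul, smul_eq_mul, smul_eq_mul] at this
    linarith
  have := discrim_le_zero key
  rw [discrim] at this
  linarith

/-- If `a²` is bounded by `N` modulo `Q`, then multiplication by `N - a²` preserves nonnegativity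
of `L` on `Q`, although it need not preserve `Q`. -/
theorem apply_sq_mul_le (hQ : IsArchimedeanQuadraticModule Q) {L : A →ₗ[ℝ] ℝ}
    (hL : ∀ q ∈ Q, 0 ≤ L q) {N : ℝ} (hN : 0 < N) {a : A} (ha : algebraMap ℝ A N - a * a ∈ Q)
    {q : A} (hq : q ∈ Q) : L (a * a * q) ≤ N * L q := by
  obtain ⟨c, hc0, -, hc⟩ := hQ.exists_pos_sub_mem q 0
  have hpow : ∀ i : ℕ, L (a ^ (2 * i)) ≤ N ^ i * L 1 := by
    intro i
    induction i with
    | zero => simp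
    | succ i ih =>
      have h1 := hL _ (hQ.pow_two_mul_mul_mem a i ha)
      have he : a ^ (2 * i) * (algebraMap ℝ A N - a * a) = N • a ^ (2 * i) - a ^ (2 * (i + 1)) := by
        rw [Algebra.smul_def]
        ring
      rw [he, map_sub, map_smul, smul_eq_mul] at h1
      have h2 := mul_le_mul_of_nonneg_left ih hN.le
      rw [pow_succ']
      linarith
  have hbound : ∀ i : ℕ, L (a ^ (2 * i) * q) ≤ c * (N ^ i * L 1) := by
    intro i
    have h1 := hL _ (hQ.pow_two_mul_mul_mem a i hc)
    have he : a ^ (2 * i) * (algebraMap ℝ A c - q) = c • a ^ (2 * i) - a ^ (2 * i) * q := by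
      rw [Algebra.smul_def]
      ring
    rw [he, map_sub, map_smul, smul_eq_mul] at h1
    linarith [mul_le_mul_of_nonneg_left (hpow i) hc0.le]
  have key := le_of_sq_le_mul_of_bounded (r := fun i => L (a ^ (2 * i) * q) / N ^ i)
    (fun i => div_nonneg (hL _ (hQ.pow_two_mul_mul_mem a i hq)) (pow_pos hN i).le)
    (fun i => by
      have h1 := hQ.apply_mul_sq_le hL hq (a ^ (2 * i))
      have he : a ^ (2 * i) * a ^ (2 * i) * q = a ^ (2 * (2 * i)) * q := by ring
      rw [he] at h1
      have h2 : (0 : ℝ) < N ^ (2 * i) := by positivity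
      simp only [mul_zero, pow_zero, one_mul, div_one]
      rw [div_pow, ← pow_mul, mul_comm i 2, ← mul_div_assoc]
      exact div_le_div_of_nonneg_right h1 h2.le)
    (c := c * L 1) (fun i => by
      have h2 : (0 : ℝ) < N ^ i := by positivity
      rw [div_le_iff₀ h2]
      linarith [hbound i])
  simp only [mul_one, pow_one, mul_zero, pow_zero, one_mul, div_one] at key
  rw [div_le_iff₀ hN, pow_two] at key
  linarith

/-- The states of `(A, Q)`: the linear functionals which are nonnegative on `Q` and send `1` to
`1`, as a subset of the space of all functions on `A` with the topology of pointwise convergence. -/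
def states (Q : Set A) : Set (A → ℝ) :=
  {φ | (∀ a b, φ (a + b) = φ a + φ b) ∧ (∀ (c : ℝ) a, φ (c • a) = c * φ a) ∧ φ 1 = 1 ∧
    ∀ q ∈ Q, 0 ≤ φ q}

/-- A state as a linear functional. -/
def stateLin {φ : A → ℝ} (hφ : φ ∈ states Q) : A →ₗ[ℝ] ℝ where
  toFun := φ
  map_add' := hφ.1
  map_smul' := hφ.2.1

theorem mem_states_of_linear {L : A →ₗ[ℝ] ℝ} (h1 : L 1 = 1) (hL : ∀ q ∈ Q, 0 ≤ L q) :
    (fun a => L a) ∈ states Q :=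
  ⟨map_add L, fun c a => by simp, h1, hL⟩

theorem isCompact_states (hQ : IsArchimedeanQuadraticModule Q) : IsCompact (states Q) := by
  have hclosed : IsClosed (states Q) := by
    simp only [states, Set.ofPred_and, Set.ofPred_forall]
    refine IsClosed.inter ?_ (IsClosed.inter ?_ (IsClosed.inter ?_ ?_))
    · exact isClosed_iInter fun a => isClosed_iInter fun b =>
        isClosed_eq (by fun_prop) (by fun_prop)
    · exact isClosed_iInter fun a => isClosed_iInter fun b =>
        isClosed_eq (by fun_prop) (by fun_prop)
    · exact isClosed_eq (by fun_prop) (by fun_prop)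
    · exact isClosed_iInter fun q => isClosed_iInter fun _ =>
        isClosed_le (by fun_prop) (by fun_prop)
  choose r hr using hQ.exists_sub_mem
  refine (isCompact_univ_pi (s := fun a => Set.Icc (-r (-a)) (r a))
    fun a => isCompact_Icc).of_isClosed_subset hclosed fun φ hφ a _ => ?_
  have key : ∀ a, φ a ≤ r a := by
    intro a
    have h : 0 ≤ stateLin hφ (algebraMap ℝ A (r a) - a) := hφ.2.2.2 _ (hr a)
    rw [map_sub, Algebra.algebraMap_eq_smul_one, map_smul] at h
    have h1 : stateLin hφ 1 = 1 := hφ.2.2.1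
    rw [h1, smul_eq_mul, mul_one] at h
    exact sub_nonneg.1 h
  refine ⟨?_, key a⟩
  have h : stateLin hφ (-a) ≤ r (-a) := key (-a)
  rw [map_neg] at h
  exact neg_le.1 h

/-- An extreme state is multiplicative. Both `a²` and `N - a²` multiply a state into a positive
multiple of a state, and the state is a convex combination of the two. -/
theorem map_sq_mul_of_mem_extremePoints (hQ : IsArchimedeanQuadraticModule Q) {φ : A → ℝ}
    (hφ : φ ∈ (states Q).extremePoints ℝ) (a f : A) : φ (a * a * f) = φ (a * a) * φ f := by
  have hmem := hφ.1
  set L := stateLin hmem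
  have hLφ : ∀ x, φ x = L x := fun _ => rfl
  have hL1 : L 1 = 1 := hmem.2.2.1
  have hL : ∀ q ∈ Q, 0 ≤ L q := hmem.2.2.2
  simp only [hLφ]
  obtain ⟨N, hN0, hN, haN⟩ := hQ.exists_pos_sub_mem (a * a) (L (a * a))
  rcases (hL _ (hQ.sq_mem a)).eq_or_lt with h0 | hpos
  · have key : ∀ g, L (a * a * g) ≤ 0 := by
      intro g
      obtain ⟨r, hr⟩ := hQ.exists_sub_mem g
      have h := hL _ (hQ.sq_mul_mem a hr)
      rw [mul_sub, mul_comm (a * a) (algebraMap ℝ A r), ← Algebra.smul_def, map_sub, map_smul,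
        ← h0, smul_zero] at h
      linarith
    have h1 := key f
    have h2 := key (-f)
    rw [mul_neg, map_neg] at h2
    rw [← h0, zero_mul]
    linarith
  · set φ₁ : A →ₗ[ℝ] ℝ := (L (a * a))⁻¹ • (L ∘ₗ LinearMap.mulLeft ℝ (a * a)) with hφ₁
    set φ₂ : A →ₗ[ℝ] ℝ :=
      (N - L (a * a))⁻¹ • (N • L - L ∘ₗ LinearMap.mulLeft ℝ (a * a)) with hφ₂
    have hN' : 0 < N - L (a * a) := sub_pos.2 hN
    have h₁ : ∀ x, φ₁ x = (L (a * a))⁻¹ * L (a * a * x) := fun x => by simp [hφ₁, mul_assoc]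
    have h₂ : ∀ x, φ₂ x = (N - L (a * a))⁻¹ * (N * L x - L (a * a * x)) := fun x => by simp [hφ₂, mul_assoc]
    have hs₁ : (fun x => φ₁ x) ∈ states Q := by
      refine mem_states_of_linear ?_ fun q hq => ?_
      · rw [h₁, mul_one, inv_mul_cancel₀ hpos.ne']
      · rw [h₁]
        exact mul_nonneg (inv_nonneg.2 hpos.le) (hL _ (hQ.sq_mul_mem a hq))
    have hs₂ : (fun x => φ₂ x) ∈ states Q := by
      refine mem_states_of_linear ?_ fun q hq => ?_
      · rw [h₂, mul_one, hL1, mul_one, inv_mul_cancel₀ hN'.ne']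
      · rw [h₂]
        exact mul_nonneg (inv_nonneg.2 hN'.le)
          (sub_nonneg.2 (hQ.apply_sq_mul_le hL hN0 haN hq))
    have hseg : φ ∈ openSegment ℝ (fun x => φ₁ x) (fun x => φ₂ x) := by
      refine ⟨L (a * a) / N, (N - L (a * a)) / N, div_pos hpos hN0, div_pos hN' hN0, ?_, ?_⟩
      · field_simp
        ring
      · ext x
        simp only [Pi.add_apply, Pi.smul_apply, smul_eq_mul, h₁, h₂, hLφ]
        field_simp
        ring
    have heq := congrFun (hφ.2 hs₁ hs₂ hseg) f
    simp only [h₁, hLφ] at heq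
    rw [← heq, mul_inv_cancel_left₀ hpos.ne']

/-- An extreme state as a character of the algebra. -/
def characterOfExtremeState (hQ : IsArchimedeanQuadraticModule Q) {φ : A → ℝ}
    (hφ : φ ∈ (states Q).extremePoints ℝ) : A →ₐ[ℝ] ℝ :=
  AlgHom.ofLinearMap (stateLin hφ.1) hφ.1.2.2.1 fun a f => by
    have hLφ : ∀ x, stateLin hφ.1 x = φ x := fun _ => rfl
    have h1 := hQ.map_sq_mul_of_mem_extremePoints hφ (a + 1) f
    have h2 := hQ.map_sq_mul_of_mem_extremePoints hφ a f
    have h3 : φ 1 = 1 := hφ.1.2.2.1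
    simp only [← hLφ] at h1 h2 h3 ⊢
    have e1 : (a + 1) * (a + 1) * f = a * a * f + (a * f + a * f) + f := by ring
    have e2 : (a + 1) * (a + 1) = a * a + (a + a) + 1 := by ring
    rw [e1, e2] at h1
    simp only [map_add, h2, h3] at h1
    linarith

/-- **Representation theorem** for Archimedean quadratic modules: an element which is nonnegative
at all characters nonnegative on `Q` has nonnegative image under every linear functional
nonnegative on `Q`. -/
theorem apply_nonneg (hQ : IsArchimedeanQuadraticModule Q) {p : A}
    (hp : ∀ χ : A →ₐ[ℝ] ℝ, (∀ q ∈ Q, 0 ≤ χ q) → 0 ≤ χ p) {L : A →ₗ[ℝ] ℝ}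
    (hL : ∀ q ∈ Q, 0 ≤ L q) : 0 ≤ L p := by
  rcases (hL 1 hQ.one_mem).eq_or_lt with h0 | hpos
  · obtain ⟨r, hr⟩ := hQ.exists_sub_mem (-p)
    have h := hL _ hr
    rw [Algebra.algebraMap_eq_smul_one, map_sub, map_smul, ← h0, smul_zero, map_neg] at h
    linarith
  · have hmem : (fun a => ((L 1)⁻¹ • L) a) ∈ states Q := by
      refine mem_states_of_linear ?_ fun q hq => ?_
      · simp [hpos.ne']
      · exact mul_nonneg (inv_nonneg.2 hpos.le) (hL q hq)
    -- The states of minimal value at `p` form a face, which has an extreme point.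
    set l : StrongDual ℝ (A → ℝ) := -ContinuousLinearMap.proj (R := ℝ) p
    have hlp : ∀ φ : A → ℝ, l φ = -φ p := fun _ => rfl
    have hexp : IsExposed ℝ (states Q) (l.toExposed (states Q)) :=
      ContinuousLinearMap.toExposed.isExposed
    have hne : (l.toExposed (states Q)).Nonempty := by
      obtain ⟨φ, hφ, hmax⟩ := hQ.isCompact_states.exists_isMaxOn ⟨_, hmem⟩
        l.continuous.continuousOn
      exact ⟨φ, hφ, fun ψ hψ => hmax hψ⟩
    obtain ⟨φ, hφ⟩ := (hexp.isCompact hQ.isCompact_states).extremePoints_nonempty hne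
    have hφmin := hφ.1.2 _ hmem
    have hφext : φ ∈ (states Q).extremePoints ℝ :=
      hexp.isExtreme.extremePoints_subset_extremePoints hφ
    have hφp : 0 ≤ φ p := hp (hQ.characterOfExtremeState hφext) fun q hq => hφext.1.2.2.2 q hq
    rw [hlp, hlp, neg_le_neg_iff] at hφmin
    have : 0 ≤ (L 1)⁻¹ * L p := hφp.trans hφmin
    exact (mul_nonneg_iff_of_pos_left (inv_pos.2 hpos)).1 this

end IsArchimedeanQuadraticModule

/-- A quadratic module of polynomials is Archimedean as soon as the squares of the variables are
bounded modulo it. -/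
theorem isArchimedeanQuadraticModule_of_sub_sq_mem {σ : Type*} {Q : Set (MvPolynomial σ ℝ)}
    (one_mem : 1 ∈ Q) (add_mem : ∀ {a b}, a ∈ Q → b ∈ Q → a + b ∈ Q)
    (sq_mul_mem : ∀ h {a}, a ∈ Q → h * h * a ∈ Q)
    (hX : ∀ l, ∃ r : ℝ, 0 ≤ r ∧ C r - X l * X l ∈ Q) : IsArchimedeanQuadraticModule Q := by
  have hsq : ∀ h, h * h ∈ Q := fun h => by simpa using sq_mul_mem h one_mem
  have hconst : ∀ {r : ℝ} {a : MvPolynomial σ ℝ}, 0 ≤ r → a ∈ Q → C r * a ∈ Q := by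
    intro r a hr ha
    have := sq_mul_mem (C √r) ha
    rwa [← map_mul, Real.mul_self_sqrt hr] at this
  have key : ∀ f : MvPolynomial σ ℝ, ∃ r : ℝ, 0 ≤ r ∧ C r - f * f ∈ Q := by
    intro f
    induction f using MvPolynomial.induction_on with
    | C c =>
      refine ⟨c * c, mul_self_nonneg c, ?_⟩
      rw [map_mul, sub_self]
      simpa using hsq 0
    | add f g hf hg =>
      obtain ⟨r, hr, hrf⟩ := hf
      obtain ⟨s, hs, hsg⟩ := hg
      refine ⟨2 * (r + s), by positivity, ?_⟩
      have : C (2 * (r + s)) - (f + g) * (f + g)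
          = C 2 * (C r - f * f) + C 2 * (C s - g * g) + (f - g) * (f - g) := by
        simp only [map_mul, map_add, map_ofNat]
        ring
      rw [this]
      exact add_mem (add_mem (hconst zero_le_two hrf) (hconst zero_le_two hsg)) (hsq _)
    | mul_X f l hf =>
      obtain ⟨r, hr, hrf⟩ := hf
      obtain ⟨s, hs, hsl⟩ := hX l
      refine ⟨r * s, mul_nonneg hr hs, ?_⟩
      have : C (r * s) - f * X l * (f * X l)
          = C s * (C r - f * f) + f * f * (C s - X l * X l) := by
        simp only [map_mul]
        ring
      rw [this]
      exact add_mem (hconst hs hrf) (sq_mul_mem f hsl)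
  refine ⟨one_mem, add_mem, sq_mul_mem, fun f => ?_⟩
  obtain ⟨r, hr, hrf⟩ := key f
  refine ⟨(r + 1) / 2, ?_⟩
  have : algebraMap ℝ (MvPolynomial σ ℝ) ((r + 1) / 2) - f
      = C (1 / 2) * (C r - f * f + (f - 1) * (f - 1)) := by
    have h2 : (C (1 / 2) : MvPolynomial σ ℝ) * 2 = 1 := by
      rw [← map_ofNat C 2, ← map_mul]
      norm_num
    have h3 : (algebraMap ℝ (MvPolynomial σ ℝ) ((r + 1) / 2)) = C (1 / 2) * (C r + 1) := by
      rw [algebraMap_eq, ← C_1, ← map_add, ← map_mul]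
      congr 1
      ring
    rw [h3]
    linear_combination f * h2
  rw [this]
  exact hconst (by norm_num) (add_mem hrf (hsq _))

/-- A functional on polynomials which is nonnegative on squares and on the multiples of
`g ∈ G` by squares is nonnegative on all polynomials which are nonnegative on the set
`{g ≥ 0, g ∈ G}`, provided that `G` bounds the variables. -/
theorem apply_nonneg_of_localizing {σ : Type*} {L : MvPolynomial σ ℝ →ₗ[ℝ] ℝ}
    {G : Set (MvPolynomial σ ℝ)} (hsq : ∀ h, 0 ≤ L (h * h))
    (hG : ∀ g ∈ G, ∀ h, 0 ≤ L (h * h * g))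
    (hX : ∀ l, ∃ r : ℝ, 0 ≤ r ∧ ∀ h, 0 ≤ L (h * h * (C r - X l * X l)))
    {p : MvPolynomial σ ℝ}
    (hp : ∀ x : σ → ℝ, (∀ g ∈ G, 0 ≤ eval x g) → 0 ≤ eval x p) : 0 ≤ L p := by
  have hQ : IsArchimedeanQuadraticModule {f | ∀ h, 0 ≤ L (h * h * f)} := by
    refine isArchimedeanQuadraticModule_of_sub_sq_mem (fun h => by simpa using hsq h)
      (fun ha hb h => ?_) (fun g a ha h => ?_) hX
    · rw [mul_add, map_add]
      exact add_nonneg (ha h) (hb h)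
    · have := ha (h * g)
      rwa [mul_mul_mul_comm, mul_assoc] at this
  refine hQ.apply_nonneg (fun χ hχ => ?_) fun q hq => by simpa using hq 1
  have hχ' : ∀ f, χ f = eval (fun l => χ (X l)) f := by
    intro f
    have : χ = aeval fun l => χ (X l) := by
      ext l
      simp
    conv_lhs => rw [this]
    rw [aeval_eq_eval]
  rw [hχ']
  refine hp _ fun g hg => ?_
  rw [← hχ']
  exact hχ g (hG g hg)

/-! ### Measures with compact support and their moments -/

section

open MeasureTheory

/-- The algebra map sending a polynomial to the continuous function `x ↦ p (ι x)`. -/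
noncomputable def polynomialFunction {σ X : Type*} [TopologicalSpace X] (ι : C(X, σ → ℝ)) :
    MvPolynomial σ ℝ →ₐ[ℝ] C(X, ℝ) :=
  AlgHom.ofLinearMap
    { toFun := fun p => ⟨fun x => eval (ι x) p, (continuous_eval p).comp ι.continuous⟩
      map_add' := fun p q => by ext x; simp
      map_smul' := fun c p => by ext x; simp [smul_eval] }
    (by ext x; simp) (fun p q => by ext x; simp)

/-- The **Riesz-Markov-Kakutani theorem** on a compact space, for functionals on `C(X, ℝ)`. -/
theorem exists_measure_of_nonneg {X : Type*} [TopologicalSpace X] [T2Space X] [CompactSpace X]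
    [MeasurableSpace X] [BorelSpace X] (Λ : C(X, ℝ) →ₗ[ℝ] ℝ)
    (hΛ : ∀ f : C(X, ℝ), (∀ x, 0 ≤ f x) → 0 ≤ Λ f) :
    ∃ μ : Measure X, IsFiniteMeasure μ ∧ ∀ f : C(X, ℝ), ∫ x, f x ∂μ = Λ f := by
  let Λ' : CompactlySupportedContinuousMap X ℝ →ₗ[ℝ] ℝ :=
    { toFun := fun f => Λ f.toContinuousMap
      map_add' := fun f g => Λ.map_add _ _
      map_smul' := fun c f => Λ.map_smul _ _ }
  let Λ'' := PositiveLinearMap.mk₀ Λ' fun f hf => hΛ _ (CompactlySupportedContinuousMap.le_def.1 hf)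
  have : IsFiniteMeasureOnCompacts (RealRMK.rieszMeasure Λ'') := by
    have : (RealRMK.rieszMeasure Λ'').Regular := inferInstance
    infer_instance
  refine ⟨RealRMK.rieszMeasure Λ'', inferInstance, fun f => ?_⟩
  exact RealRMK.integral_rieszMeasure Λ'' (CompactlySupportedContinuousMap.continuousMapEquiv f)

/-- **Haviland's theorem** for a compact set: a functional on polynomials which is nonnegative on
the polynomials nonnegative on `K` is the integral against a measure carried by `K`. -/
theorem exists_measure_of_nonneg_on_compact {σ : Type*} [Finite σ] {K : Set (σ → ℝ)}
    (hK : IsCompact K) {L : MvPolynomial σ ℝ →ₗ[ℝ] ℝ}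
    (hL : ∀ p, (∀ x ∈ K, 0 ≤ eval x p) → 0 ≤ L p) :
    ∃ μ : Measure (σ → ℝ), IsFiniteMeasure μ ∧ μ Kᶜ = 0 ∧ ∀ p, ∫ x, eval x p ∂μ = L p := by
  have : CompactSpace K := isCompact_iff_compactSpace.1 hK
  have := Fintype.ofFinite σ
  let ρ : MvPolynomial σ ℝ →ₗ[ℝ] C(K, ℝ) :=
    (polynomialFunction (⟨Subtype.val, continuous_subtype_val⟩ : C(K, σ → ℝ))).toLinearMap
  have hρ : ∀ p (x : K), ρ p x = eval x.1 p := fun p x => rfl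
  obtain ⟨s, hs⟩ := ρ.rangeRestrict.exists_rightInverse_of_surjective ρ.range_rangeRestrict
  have hρs : ∀ f : LinearMap.range ρ, ρ (s f) = f := fun f =>
    congrArg Subtype.val (LinearMap.congr_fun hs f)
  have hLeq : ∀ p q, (∀ x ∈ K, eval x p = eval x q) → L p = L q := by
    intro p q h
    have h1 := hL (p - q) fun x hx => by rw [map_sub, h x hx, sub_self]
    have h2 := hL (q - p) fun x hx => by rw [map_sub, h x hx, sub_self]
    rw [map_sub] at h1 h2
    linarith
  let f : C(K, ℝ) →ₗ.[ℝ] ℝ := ⟨LinearMap.range ρ, L ∘ₗ s⟩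
  let P : PointedCone ℝ C(K, ℝ) :=
    { carrier := {f | ∀ x, 0 ≤ f x}
      add_mem' := fun hf hg x => add_nonneg (hf x) (hg x)
      zero_mem' := fun x => le_rfl
      smul_mem' := fun c f hf x => mul_nonneg c.2 (hf x) }
  obtain ⟨Λ, hΛf, hΛ⟩ := riesz_extension P f (fun g hg => by
      refine hL _ fun x hx => ?_
      rw [← hρ _ ⟨x, hx⟩, hρs]
      exact hg ⟨x, hx⟩)
    (fun g => ⟨⟨ρ (C ‖g‖), LinearMap.mem_range_self _ _⟩, fun x => by
      have h1 := (abs_le.1 (g.norm_coe_le_norm x)).1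
      have h2 : ρ (C ‖g‖) x = ‖g‖ := by rw [hρ, eval_C]
      change 0 ≤ ρ (C ‖g‖) x + g x
      linarith⟩)
  obtain ⟨μ, hμ, hint⟩ := exists_measure_of_nonneg Λ hΛ
  refine ⟨μ.map Subtype.val, inferInstance, ?_, fun p => ?_⟩
  · rw [Measure.map_apply measurable_subtype_coe hK.measurableSet.compl]
    convert measure_empty (μ := μ)
    ext x
    simp
  · rw [integral_map measurable_subtype_coe.aemeasurable
      (continuous_eval p).aestronglyMeasurable]
    have h1 := hint (ρ p)
    have h2 := hΛf ⟨ρ p, LinearMap.mem_range_self _ _⟩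
    simp only [hρ] at h1
    rw [h1]
    refine h2.trans (hLeq _ _ fun x hx => ?_)
    rw [← hρ _ ⟨x, hx⟩, hρs]
    rfl

theorem integrable_of_bound_on {Ω : Type*} [MeasurableSpace Ω] {μ : Measure Ω}
    [IsFiniteMeasure μ] {K : Set Ω} (hμ : μ Kᶜ = 0) {f : Ω → ℝ} (hf : Measurable f) {c : ℝ}
    (hc : ∀ x ∈ K, |f x| ≤ c) : Integrable f μ := by
  refine Integrable.of_bound hf.aestronglyMeasurable c ?_
  filter_upwards [show ∀ᵐ x ∂μ, x ∈ K from hμ] with x hx using hc x hx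

theorem integrable_of_continuousOn_compact {σ : Type*} [Finite σ] {μ : Measure (σ → ℝ)}
    [IsFiniteMeasure μ] {K : Set (σ → ℝ)} (hK : IsCompact K) (hμ : μ Kᶜ = 0) {f : (σ → ℝ) → ℝ}
    (hf : Measurable f) (hfK : ContinuousOn f K) : Integrable f μ := by
  obtain ⟨c, hc⟩ := hK.exists_bound_of_continuousOn hfK
  exact integrable_of_bound_on hμ hf hc

/-- A finite measure carried by a compact set is determined by its moments. -/
theorem measure_eq_of_forall_integral_monomial_eq {σ : Type*} [Finite σ] {μ ν : Measure (σ → ℝ)}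
    [IsFiniteMeasure μ] [IsFiniteMeasure ν] {K : Set (σ → ℝ)} (hK : IsCompact K) (hμ : μ Kᶜ = 0)
    (hν : ν Kᶜ = 0)
    (h : ∀ α : σ →₀ ℕ, ∫ x, eval x (monomial α (1 : ℝ)) ∂μ = ∫ x, eval x (monomial α 1) ∂ν) :
    μ = ν := by
  have := Fintype.ofFinite σ
  have hint : ∀ (τ : Measure (σ → ℝ)) [IsFiniteMeasure τ], τ Kᶜ = 0 → ∀ f : (σ → ℝ) → ℝ,
      Continuous f → Integrable f τ := fun τ _ hτ f hf =>
    integrable_of_continuousOn_compact hK hτ hf.measurable hf.continuousOn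
  have hpoly : ∀ p : MvPolynomial σ ℝ, ∫ x, eval x p ∂μ = ∫ x, eval x p ∂ν := by
    intro p
    have hsum : ∀ x : σ → ℝ,
        eval x p = ∑ α ∈ p.support, p.coeff α * eval x (monomial α (1 : ℝ)) := fun x => by
      conv_lhs => rw [p.as_sum, map_sum]
      exact Finset.sum_congr rfl fun α _ => by simp [eval_monomial]
    simp only [hsum]
    rw [integral_finsetSum _ fun α _ => ((hint μ hμ _ (continuous_eval _)).const_mul _),
      integral_finsetSum _ fun α _ => ((hint ν hν _ (continuous_eval _)).const_mul _)]
    exact Finset.sum_congr rfl fun α _ => by rw [integral_const_mul, integral_const_mul, h]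
  refine ext_of_forall_integral_eq_of_IsFiniteMeasure fun f => ?_
  have hsep : (polynomialFunction (ContinuousMap.id (σ → ℝ))).range.SeparatesPoints := by
    intro x x' hxx'
    obtain ⟨l, hl⟩ := Function.ne_iff.1 hxx'
    refine ⟨_, ⟨_, ⟨X l, rfl⟩, rfl⟩, ?_⟩
    change eval x (X l) ≠ eval x' (X l)
    simpa using hl
  -- Both integrals are within `ε * mass` of the integral of the same polynomial.
  have key : ∀ ε : ℝ, 0 < ε →
      |∫ x, f x ∂μ - ∫ x, f x ∂ν| ≤ ε * (μ.real Set.univ + ν.real Set.univ) := by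
    intro ε hε
    obtain ⟨_, ⟨p, rfl⟩, hp⟩ :=
      ContinuousMap.exists_mem_subalgebra_near_continuous_of_isCompact_of_separatesPoints hsep
        f.toContinuousMap hK hε
    have happrox : ∀ (τ : Measure (σ → ℝ)) [IsFiniteMeasure τ], τ Kᶜ = 0 →
        |∫ x, f x ∂τ - ∫ x, eval x p ∂τ| ≤ ε * τ.real Set.univ := by
      intro τ _ hτ
      rw [← integral_sub (hint τ hτ _ f.continuous) (hint τ hτ _ (continuous_eval p))]
      rw [← Real.norm_eq_abs]
      refine norm_integral_le_of_norm_le_const (μ := τ) ?_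
      filter_upwards [show ∀ᵐ x ∂τ, x ∈ K from hτ] with x hx
      rw [norm_sub_rev]
      exact (hp x hx).le
    have h1 := happrox μ hμ
    have h2 := happrox ν hν
    rw [hpoly p] at h1
    rw [abs_sub_comm] at h2
    have h3 := abs_sub_le (∫ x, f x ∂μ) (∫ x, eval x p ∂ν) (∫ x, f x ∂ν)
    rw [mul_add]
    linarith
  have hzero : |∫ x, f x ∂μ - ∫ x, f x ∂ν| ≤ 0 := by
    refine le_of_forall_pos_le_add fun δ hδ => ?_
    set c := μ.real Set.univ + ν.real Set.univ
    have hc : 0 ≤ c := by positivity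
    have h1 := key (δ / (c + 1)) (by positivity)
    have h2 : δ / (c + 1) * c ≤ δ := by
      rw [div_mul_eq_mul_div, div_le_iff₀ (by positivity)]
      nlinarith
    linarith
  exact sub_eq_zero.1 (abs_nonpos_iff.1 hzero)

end

/-! ### Gluing measures along the running intersection property -/

section

open MeasureTheory ProbabilityTheory

/-- Two probability measures with the same image in `Z` have a coupling concentrated on the fibre
product over `Z`: the two disintegrations over the common image are taken to be conditionally
independent. -/
theorem exists_coupling_over {X Y Z : Type*} [MeasurableSpace X] [StandardBorelSpace X] [Nonempty X]
    [MeasurableSpace Y] [StandardBorelSpace Y] [Nonempty Y] [MeasurableSpace Z]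
    [StandardBorelSpace Z] (μ : Measure X) [IsProbabilityMeasure μ] (ν : Measure Y)
    [IsProbabilityMeasure ν] {f : X → Z} {g : Y → Z} (hf : Measurable f) (hg : Measurable g)
    (h : μ.map f = ν.map g) :
    ∃ π : Measure (X × Y), IsProbabilityMeasure π ∧ π.map Prod.fst = μ ∧ π.map Prod.snd = ν ∧
      ∀ᵐ p ∂π, f p.1 = g p.2 := by
  set κ₁ := condDistrib id f μ
  set κ₂ := condDistrib id g ν
  have h₁ : (μ.map f) ⊗ₘ κ₁ = μ.map fun x => (f x, x) :=
    compProd_map_condDistrib measurable_id.aemeasurable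
  have h₂ : (μ.map f) ⊗ₘ κ₂ = ν.map fun y => (g y, y) := by
    rw [h]
    exact compProd_map_condDistrib measurable_id.aemeasurable
  have : IsProbabilityMeasure (μ.map f) := Measure.isProbabilityMeasure_map hf.aemeasurable
  set τ := (μ.map f) ⊗ₘ (κ₁ ×ₖ κ₂)
  have hτ₁ : τ.map (Prod.map id Prod.fst) = μ.map fun x => (f x, x) := by
    rw [← h₁, ← Measure.compProd_map measurable_fst, ← Kernel.fst_eq, Kernel.fst_prod]
  have hτ₂ : τ.map (Prod.map id Prod.snd) = ν.map fun y => (g y, y) := by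
    rw [← h₂, ← Measure.compProd_map measurable_snd, ← Kernel.snd_eq, Kernel.snd_prod]
  have hae₁ : ∀ᵐ p ∂τ, p.1 = f p.2.1 := by
    have : ∀ᵐ q ∂τ.map (Prod.map id Prod.fst), q.1 = f q.2 := by
      rw [hτ₁, ae_map_iff (by fun_prop) (measurableSet_eq_fun (by fun_prop) (by fun_prop))]
      exact Filter.Eventually.of_forall fun x => rfl
    exact ae_of_ae_map (by fun_prop) this
  have hae₂ : ∀ᵐ p ∂τ, p.1 = g p.2.2 := by
    have : ∀ᵐ q ∂τ.map (Prod.map id Prod.snd), q.1 = g q.2 := by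
      rw [hτ₂, ae_map_iff (by fun_prop) (measurableSet_eq_fun (by fun_prop) (by fun_prop))]
      exact Filter.Eventually.of_forall fun x => rfl
    exact ae_of_ae_map (by fun_prop) this
  refine ⟨τ.map Prod.snd, Measure.isProbabilityMeasure_map (by fun_prop), ?_, ?_, ?_⟩
  · have := congrArg (Measure.map Prod.snd) hτ₁
    rw [Measure.map_map (by fun_prop) (by fun_prop), Measure.map_map (by fun_prop) (by fun_prop)]
      at this
    rw [Measure.map_map (by fun_prop) (by fun_prop)]
    exact this.trans Measure.map_id
  · have := congrArg (Measure.map Prod.snd) hτ₂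
    rw [Measure.map_map (by fun_prop) (by fun_prop), Measure.map_map (by fun_prop) (by fun_prop)]
      at this
    rw [Measure.map_map (by fun_prop) (by fun_prop)]
    exact this.trans Measure.map_id
  · rw [ae_map_iff (by fun_prop) (measurableSet_eq_fun (by fun_prop) (by fun_prop))]
    filter_upwards [hae₁, hae₂] with p hp₁ hp₂ using hp₁.symm.trans hp₂

theorem map_restrict_eq_of_subset {ι : Type*} {μ ν : Measure (ι → ℝ)} {S T : Finset ι} (hTS : T ⊆ S)
    (h : μ.map S.restrict = ν.map S.restrict) : μ.map T.restrict = ν.map T.restrict := by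
  let r : (S → ℝ) → T → ℝ := fun z l => z ⟨l.1, hTS l.2⟩
  have hr : Measurable r := by fun_prop
  have hcomp : (T.restrict : (ι → ℝ) → T → ℝ) = r ∘ S.restrict := rfl
  rw [hcomp, ← Measure.map_map hr (by fun_prop), ← Measure.map_map hr (by fun_prop), h]

theorem map_restrict_empty_eq {ι : Type*} (μ ν : Measure (ι → ℝ)) [IsProbabilityMeasure μ]
    [IsProbabilityMeasure ν] :
    μ.map (∅ : Finset ι).restrict = ν.map (∅ : Finset ι).restrict := by
  have h : (Finset.restrict (π := fun _ => ℝ) (∅ : Finset ι)) = fun _ => default :=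
    funext fun _ => Subsingleton.elim _ _
  rw [h, Measure.map_const, Measure.map_const, measure_univ, measure_univ]

section Restrict

variable {ι : Type*} [Fintype ι] [DecidableEq ι]

/-- A measure `ν` can be glued to `π` if both have the same marginal on the coordinates `T`: there
is a measure with the same marginal as `ν` on `I`, and the same marginals as `π` on every set of
coordinates which meets `I` in `T` only. -/
theorem exists_glued_measure (π ν : Measure (ι → ℝ)) [IsProbabilityMeasure π]
    [IsProbabilityMeasure ν] {I T : Finset ι} (h : π.map T.restrict = ν.map T.restrict) :
    ∃ π' : Measure (ι → ℝ), IsProbabilityMeasure π' ∧ π'.map I.restrict = ν.map I.restrict ∧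
      ∀ S : Finset ι, I ∩ S ⊆ T → π'.map S.restrict = π.map S.restrict := by
  obtain ⟨τ, hτ, hτ₁, hτ₂, hae⟩ := exists_coupling_over π ν (by fun_prop) (by fun_prop) h
  set merge : (ι → ℝ) × (ι → ℝ) → ι → ℝ := fun p l => if l ∈ I then p.2 l else p.1 l with hmerge
  have hm : Measurable merge := by
    refine measurable_pi_lambda _ fun l => ?_
    by_cases hl : l ∈ I
    · simp only [hmerge, hl, if_true]
      fun_prop
    · simp only [hmerge, hl, if_false]
      fun_prop
  refine ⟨τ.map merge, Measure.isProbabilityMeasure_map hm.aemeasurable, ?_, fun S hS => ?_⟩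
  · rw [← hτ₂, Measure.map_map (by fun_prop) hm, Measure.map_map (by fun_prop) (by fun_prop)]
    congr 1
    ext p l
    simp [hmerge]
  · rw [← hτ₁, Measure.map_map (by fun_prop) hm, Measure.map_map (by fun_prop) (by fun_prop)]
    refine Measure.map_congr ?_
    filter_upwards [hae] with p hp
    ext l
    simp only [Function.comp_apply, Finset.restrict, hmerge]
    split_ifs with hl
    · exact (congrFun hp ⟨l.1, hS (Finset.mem_inter.2 ⟨hl, l.2⟩)⟩).symm
    · rfl

/-- Probability measures with compatible marginals on the blocks of a family with the running
intersection property are the marginals of one probability measure. -/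
theorem exists_measure_of_running_intersection {N : ℕ} (I : Fin N → Finset ι)
    (hrip : ∀ i : Fin N, 0 < (i : ℕ) → ∃ j < i, I i ∩ (Finset.Iio i).biUnion I ⊆ I j)
    (ν : Fin N → Measure (ι → ℝ)) [∀ i, IsProbabilityMeasure (ν i)]
    (hν : ∀ i j, j < i → (ν j).map (I i ∩ I j).restrict = (ν i).map (I i ∩ I j).restrict) :
    ∃ π : Measure (ι → ℝ), IsProbabilityMeasure π ∧
      ∀ i, π.map (I i).restrict = (ν i).map (I i).restrict := by
  have key : ∀ k : ℕ, k ≤ N → ∃ π : Measure (ι → ℝ), IsProbabilityMeasure π ∧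
      ∀ i : Fin N, (i : ℕ) < k → π.map (I i).restrict = (ν i).map (I i).restrict := by
    intro k
    induction k with
    | zero => exact fun _ => ⟨Measure.dirac 0, inferInstance, fun i hi => absurd hi (Nat.not_lt_zero _)⟩
    | succ k ih =>
      intro hk
      obtain ⟨π, hπ, hπν⟩ := ih (by omega)
      set i : Fin N := ⟨k, hk⟩ with hi
      set T := I i ∩ (Finset.Iio i).biUnion I with hT
      have hagree : π.map T.restrict = (ν i).map T.restrict := by
        rcases Nat.eq_zero_or_pos k with h0 | hpos
        · have hempty : T = ∅ := by
            have : Finset.Iio i = ∅ := by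
              ext j
              simp [Fin.lt_def, hi, h0]
            rw [hT, this, Finset.biUnion_empty, Finset.inter_empty]
          rw [hempty]
          exact map_restrict_empty_eq π (ν i)
        · obtain ⟨j, hj, hsub⟩ := hrip i hpos
          rw [map_restrict_eq_of_subset hsub (hπν j hj)]
          exact map_restrict_eq_of_subset (Finset.subset_inter Finset.inter_subset_left hsub)
            (hν i j hj)
      obtain ⟨π', hπ', hI, hS⟩ := exists_glued_measure π (ν i) (I := I i) hagree
      refine ⟨π', hπ', fun j hj => ?_⟩
      rcases Nat.lt_succ_iff_lt_or_eq.1 hj with hlt | heq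
      · rw [hS (I j), hπν j hlt]
        exact Finset.inter_subset_inter_left
          (Finset.subset_biUnion_of_mem I (Finset.mem_Iio.2 hlt))
      · obtain rfl : j = i := Fin.ext heq
        exact hI
  obtain ⟨π, hπ, h⟩ := key N le_rfl
  exact ⟨π, hπ, fun i => h i i.2⟩

end Restrict

end

/-! ### The relaxations and their feasible points -/

namespace SparseProblem

variable {n N m : ℕ} {P : SparseProblem n N m}

theorem totalDegree_con_le (P : SparseProblem n N m) (c : Fin m ⊕ Fin N) :
    (P.con c).totalDegree ≤ 2 * P.halfDeg c := by
  rw [halfDeg]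
  omega

theorem halfDeg_ball_le_one (P : SparseProblem n N m) (i : Fin N) :
    P.halfDeg (Sum.inr i) ≤ 1 := by
  have : (P.con (Sum.inr i)).totalDegree ≤ 2 := by
    refine (totalDegree_sub _ _).trans (max_le (by simp) ?_)
    refine totalDegree_finsetSum_le fun l _ => ?_
    exact (totalDegree_pow _ _).trans (by simp)
  rw [halfDeg]
  omega

theorem one_le_halfDeg_ball (P : SparseProblem n N m) {i : Fin N} (h : (P.I i).Nonempty) :
    1 ≤ P.halfDeg (Sum.inr i) := by
  obtain ⟨l, hl⟩ := h
  have hcoeff : (P.con (Sum.inr i)).coeff (Finsupp.single l 2) ≠ 0 := by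
    classical
    have h0 : (0 : Fin n →₀ ℕ) ≠ Finsupp.single l 2 := by
      intro h
      simpa using congrArg (fun f => f l) h
    have h1 : ∀ l', Finsupp.single l' 2 = Finsupp.single l 2 ↔ l' = l := fun l' =>
      ⟨fun h => ((Finsupp.single_eq_single_iff _ _ _ _).1 h).elim (fun h => h.1) (by simp),
        fun h => by rw [h]⟩
    simp only [con, coeff_sub, coeff_C, h0, if_false, coeff_sum, coeff_X_pow, h1,
      Finset.sum_ite_eq', hl, if_true]
    norm_num
  have := le_totalDegree (mem_support_iff.2 hcoeff)
  rw [Finsupp.sum_single_index rfl] at this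
  rw [halfDeg]
  omega

theorem IsFeasible.mono {k k' : ℕ} (hk : k ≤ k') {y : Fin N → (Fin n →₀ ℕ) → ℝ}
    (h : P.IsFeasible k' y) : P.IsFeasible k y where
  moment i := by
    have := h.moment i
    rw [momentMatrix_posSemidef_iff] at this ⊢
    exact fun f hf => this f (hf.trans (monos_mono le_rfl hk))
  localizing i c hc := by
    have := h.localizing i c hc
    rw [localizingMatrix_posSemidef_iff] at this ⊢
    exact fun f hf => this f (hf.trans (monos_mono le_rfl (Nat.sub_le_sub_right hk _)))
  normalized := h.normalized
  coupling i j hij hne α hα hd := h.coupling i j hij hne α hα (hd.trans (by omega))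

theorem relaxVal_mono (P : SparseProblem n N m) : Monotone P.relaxVal := fun _ _ hk =>
  le_iInf₂ fun y hy => iInf₂_le y (hy.mono hk)

theorem restrict_mem_blockK_of_mem_K (hcv : ∀ i, ∀ c ∈ P.J i, (P.con c).vars ⊆ P.I i)
    (hKM : ∀ x ∈ P.K, ∑ l, x l ^ 2 ≤ P.M) {x : Fin n → ℝ} (hx : x ∈ P.K) (i : Fin N) :
    (P.I i).restrict x ∈ P.blockK i := by
  rw [restrict_mem_blockK hcv]
  rintro (j | i') _
  · exact hx j
  · simp only [con, map_sub, eval_C, map_sum, map_pow, eval_X, sub_nonneg]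
    exact (Finset.sum_le_univ_sum_of_nonneg fun l => sq_nonneg (x l)).trans (hKM x hx)

theorem mem_K_of_restrict_mem_blockK (hcv : ∀ i, ∀ c ∈ P.J i, (P.con c).vars ⊆ P.I i)
    (hJ : ∀ c, ∃! i, c ∈ P.J i) {x : Fin n → ℝ} (hx : ∀ i, (P.I i).restrict x ∈ P.blockK i) :
    x ∈ P.K := by
  intro j
  obtain ⟨i, hi, -⟩ := hJ (Sum.inl j)
  exact (restrict_mem_blockK hcv).1 (hx i) _ hi

/-- A point `x` of `K` gives a feasible point of every relaxation, namely the moments of the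
measures `δ_x / q_i(x)`, with the same objective value. -/
theorem exists_isFeasible_of_mem_K (hcv : ∀ i, ∀ c ∈ P.J i, (P.con c).vars ⊆ P.I i)
    (hKM : ∀ x ∈ P.K, ∑ l, x l ^ 2 ≤ P.M) (hq : ∀ i, (P.q i).vars ⊆ P.I i)
    (hqpos : ∀ i, ∀ z ∈ P.blockK i, 0 < eval (extendZero z) (P.q i)) {x : Fin n → ℝ}
    (hx : x ∈ P.K) (k : ℕ) :
    ∃ y, P.IsFeasible k y ∧ P.relaxObjective y = P.objective x := by
  have hmem := restrict_mem_blockK_of_mem_K hcv hKM hx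
  have hpos : ∀ i, 0 < eval x (P.q i) := fun i => by
    have := hqpos i _ (hmem i)
    rwa [eval_extendZero_restrict (hq i)] at this
  set y : Fin N → (Fin n →₀ ℕ) → ℝ := fun i α => (eval x (P.q i))⁻¹ * eval x (monomial α 1)
  have hy : ∀ i f, rieszL (y i) f = (eval x (P.q i))⁻¹ * eval x f := fun i f => by
    rw [rieszL_smul_left, rieszL_eval]
  refine ⟨y, ⟨fun i => ?_, fun i c hc => ?_, fun i => ?_, fun i j _ _ α _ _ => ?_⟩, ?_⟩
  · rw [momentMatrix_posSemidef_iff]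
    intro h _
    rw [hy, map_mul]
    exact mul_nonneg (inv_nonneg.2 (hpos i).le) (mul_self_nonneg _)
  · rw [localizingMatrix_posSemidef_iff]
    intro h _
    rw [hy, map_mul, map_mul]
    exact mul_nonneg (inv_nonneg.2 (hpos i).le)
      (mul_nonneg (mul_self_nonneg _) ((restrict_mem_blockK hcv).1 (hmem i) c hc))
  · rw [hy, inv_mul_cancel₀ (hpos i).ne']
  · rw [hy, hy, map_mul, map_mul, mul_left_comm, inv_mul_cancel₀ (hpos i).ne', mul_left_comm,
      inv_mul_cancel₀ (hpos j).ne']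
  · simp only [relaxObjective, objective, hy]
    exact Finset.sum_congr rfl fun i _ => by rw [div_eq_inv_mul]

theorem relaxVal_le_optVal (hcv : ∀ i, ∀ c ∈ P.J i, (P.con c).vars ⊆ P.I i)
    (hKM : ∀ x ∈ P.K, ∑ l, x l ^ 2 ≤ P.M) (hq : ∀ i, (P.q i).vars ⊆ P.I i)
    (hqpos : ∀ i, ∀ z ∈ P.blockK i, 0 < eval (extendZero z) (P.q i)) (k : ℕ) :
    P.relaxVal k ≤ P.optVal := by
  refine le_iInf₂ fun x hx => ?_
  obtain ⟨y, hy, hobj⟩ := exists_isFeasible_of_mem_K hcv hKM hq hqpos hx k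
  rw [← hobj]
  exact iInf₂_le y hy

/-! ### Bounds on the moments of a feasible point -/

section Bounds

variable {k : ℕ} {y : Fin N → (Fin n →₀ ℕ) → ℝ} {i : Fin N}

theorem IsFeasible.apply_add_self_nonneg (h : P.IsFeasible k y) {α : Fin n →₀ ℕ}
    (hα : α ∈ monos (P.I i) k) : 0 ≤ y i (α + α) := by
  have := (momentMatrix_posSemidef_iff _ _ _).1 (h.moment i) (monomial α 1)
    (monomial_support_subset_monos hα 1)
  rwa [monomial_mul, rieszL_eq, rieszLin_monomial, one_mul, one_mul] at this

theorem IsFeasible.apply_zero_nonneg (h : P.IsFeasible k y) : 0 ≤ y i 0 := by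
  simpa using h.apply_add_self_nonneg (i := i) (zero_mem_monos (k := k))

/-- The Cauchy-Schwarz inequality for the moments. -/
theorem IsFeasible.apply_sq_le (h : P.IsFeasible k y) {α : Fin n →₀ ℕ}
    (hα : α ∈ monos (P.I i) k) : y i α ^ 2 ≤ y i 0 * y i (α + α) := by
  have key : ∀ t : ℝ, 0 ≤ y i 0 * (t * t) + 2 * y i α * t + y i (α + α) := by
    intro t
    have := (momentMatrix_posSemidef_iff _ _ _).1 (h.moment i) (monomial 0 t + monomial α 1)
      (support_add.trans (Finset.union_subset (monomial_support_subset_monos zero_mem_monos t)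
        (monomial_support_subset_monos hα 1)))
    rw [add_mul, mul_add, mul_add] at this
    simp only [monomial_mul, rieszL_eq, map_add, rieszLin_monomial, add_zero, zero_add, mul_one,
      one_mul] at this
    linarith
  have := discrim_le_zero key
  rw [discrim] at this
  linarith

/-- The ball constraint of a block bounds the growth of the even moments. -/
theorem IsFeasible.apply_add_single_le (h : P.IsFeasible k y) (hJball : Sum.inr i ∈ P.J i)
    {α : Fin n →₀ ℕ} {l : Fin n} (hl : l ∈ P.I i) (hα : α.support ⊆ P.I i)
    (hd : α.degree + 1 ≤ k) :
    y i (α + Finsupp.single l 1 + (α + Finsupp.single l 1)) ≤ P.M * y i (α + α) := by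
  have hαm : α ∈ monos (P.I i) (k - 1) := mem_monos.2 ⟨hα, by omega⟩
  have hone := P.halfDeg_ball_le_one i
  have hαm' : α ∈ monos (P.I i) (k - P.halfDeg (Sum.inr i)) :=
    monos_mono le_rfl (by omega) hαm
  have := (localizingMatrix_posSemidef_iff _ _ _ _).1 (h.localizing i _ hJball) (monomial α 1)
    (monomial_support_subset_monos hαm' 1)
  have he : monomial α (1 : ℝ) * monomial α 1 * P.con (Sum.inr i)
      = monomial (α + α) P.M - ∑ l ∈ P.I i,
        monomial (α + Finsupp.single l 1 + (α + Finsupp.single l 1)) 1 := by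
    simp only [con, mul_sub, Finset.mul_sum, monomial_mul, X_pow_eq_monomial, mul_one]
    congr 1
    · rw [mul_comm, C_mul_monomial, mul_one]
    · refine Finset.sum_congr rfl fun l _ => ?_
      have : Finsupp.single l 2 = Finsupp.single l 1 + Finsupp.single l 1 := by
        rw [← Finsupp.single_add]
      rw [this, add_add_add_comm]
  rw [he, rieszL_eq, map_sub, map_sum, rieszLin_monomial] at this
  simp only [rieszLin_monomial, one_mul] at this
  have hle := Finset.single_le_sum (f := fun l =>
    y i (α + Finsupp.single l 1 + (α + Finsupp.single l 1))) (s := P.I i) (fun l hl =>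
      h.apply_add_self_nonneg (monos_mono le_rfl (by omega) (add_single_mem_monos hl hαm))) hl
  linarith

theorem IsFeasible.apply_add_self_le (h : P.IsFeasible k y) (hJball : Sum.inr i ∈ P.J i)
    (hM : 0 < P.M) {α : Fin n →₀ ℕ} (hα : α ∈ monos (P.I i) k) :
    y i (α + α) ≤ y i 0 * P.M ^ α.degree := by
  obtain ⟨d, hd⟩ : ∃ d, α.degree = d := ⟨_, rfl⟩
  induction d generalizing α with
  | zero => rw [(Finsupp.degree_eq_zero_iff α).1 hd]; simp
  | succ d ih =>
    obtain ⟨hαI, hαk⟩ := mem_monos.1 hα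
    obtain ⟨l, hl⟩ : α.support.Nonempty := by
      rw [Finsupp.support_nonempty_iff]
      rintro rfl
      simp at hd
    have hαl : α - Finsupp.single l 1 + Finsupp.single l 1 = α :=
      Finsupp.sub_add_single_one_cancel (Finsupp.mem_support_iff.1 hl)
    have hβI : (α - Finsupp.single l 1).support ⊆ P.I i :=
      (Finsupp.support_mono tsub_le_self).trans hαI
    set β := α - Finsupp.single l 1
    have hβd : β.degree = d := by
      have := congrArg Finsupp.degree hαl
      rw [map_add, Finsupp.degree_single] at this
      omega
    have h1 := ih (mem_monos.2 ⟨hβI, by omega⟩) hβd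
    have h2 := h.apply_add_single_le hJball (hαI hl) hβI (by omega)
    rw [hαl] at h2
    rw [hd, pow_succ]
    rw [hβd] at h1
    nlinarith [mul_le_mul_of_nonneg_left h1 hM.le]

theorem IsFeasible.abs_apply_le (h : P.IsFeasible k y) (hJball : Sum.inr i ∈ P.J i)
    (hM : 0 < P.M) {α : Fin n →₀ ℕ} (hα : α ∈ monos (P.I i) k) :
    |y i α| ≤ y i 0 * (P.M + 1) ^ α.degree := by
  have h0 : 0 ≤ y i 0 := h.apply_zero_nonneg
  refine abs_le_of_sq_le_sq ?_ (by positivity)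
  calc y i α ^ 2 ≤ y i 0 * (y i 0 * P.M ^ α.degree) :=
        (h.apply_sq_le hα).trans (mul_le_mul_of_nonneg_left (h.apply_add_self_le hJball hM hα) h0)
    _ ≤ y i 0 * (y i 0 * ((P.M + 1) ^ 2) ^ α.degree) := by
        gcongr
        nlinarith
    _ = _ := by rw [mul_pow, ← pow_mul, ← pow_mul, mul_comm 2]; ring

theorem IsFeasible.abs_rieszL_le (h : P.IsFeasible k y) (hJball : Sum.inr i ∈ P.J i)
    (hM : 0 < P.M) {f : MvPolynomial (Fin n) ℝ} (hf : f.support ⊆ monos (P.I i) k) :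
    |rieszL (y i) f| ≤ y i 0 * ∑ α ∈ f.support, |f.coeff α| * (P.M + 1) ^ α.degree := by
  rw [rieszL, Finset.mul_sum]
  refine (Finset.abs_sum_le_sum_abs _ _).trans (Finset.sum_le_sum fun α hα => ?_)
  rw [abs_mul, mul_left_comm]
  exact mul_le_mul_of_nonneg_left (h.abs_apply_le hJball hM (hf hα)) (abs_nonneg _)

theorem IsFeasible.apply_zero_pos (h : P.IsFeasible k y) (hJball : Sum.inr i ∈ P.J i)
    (hM : 0 < P.M) (hq : (P.q i).support ⊆ monos (P.I i) k) : 0 < y i 0 := by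
  refine h.apply_zero_nonneg.lt_of_ne fun h0 => ?_
  have := h.abs_rieszL_le hJball hM hq
  rw [h.normalized, ← h0, zero_mul, abs_one] at this
  exact absurd this (by norm_num)

end Bounds

end SparseProblem

/-! ### Limits of feasible points -/

/-- A pointwise bounded sequence of linear functionals has a pointwise limit along every
ultrafilter. -/
theorem exists_linear_ultralimit {V : Type*} [AddCommGroup V] [Module ℝ V] (𝒰 : Ultrafilter ℕ)
    (F : ℕ → V →ₗ[ℝ] ℝ) (hF : ∀ v, ∃ B : ℝ, ∀ᶠ k in (𝒰 : Filter ℕ), |F k v| ≤ B) :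
    ∃ Λ : V →ₗ[ℝ] ℝ, ∀ v, Filter.Tendsto (fun k => F k v) 𝒰 (nhds (Λ v)) := by
  have hlim : ∀ v, ∃ a, Filter.Tendsto (fun k => F k v) 𝒰 (nhds a) := by
    intro v
    obtain ⟨B, hB⟩ := hF v
    obtain ⟨a, -, ha⟩ := (isCompact_Icc (a := -B) (b := B)).ultrafilter_le_nhds'
      (𝒰.map fun k => F k v) (hB.mono fun k hk => abs_le.1 hk)
    exact ⟨a, ha⟩
  choose Λ hΛ using hlim
  refine ⟨⟨⟨Λ, fun v w => ?_⟩, fun c v => ?_⟩, hΛ⟩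
  · refine tendsto_nhds_unique (hΛ (v + w)) ?_
    simpa using (hΛ v).add (hΛ w)
  · refine tendsto_nhds_unique (hΛ (c • v)) ?_
    simpa using (hΛ v).const_mul c

/-- The algebra map which substitutes `0` for the variables outside `I`. -/
noncomputable def blockProj {n : ℕ} (I : Finset (Fin n)) :
    MvPolynomial (Fin n) ℝ →ₐ[ℝ] MvPolynomial (Fin n) ℝ :=
  aeval fun l => if l ∈ I then X l else 0

theorem vars_blockProj {n : ℕ} (I : Finset (Fin n)) (f : MvPolynomial (Fin n) ℝ) :
    (blockProj I f).vars ⊆ I := by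
  have : blockProj I f ∈ supported ℝ (I : Set (Fin n)) := by
    induction f using MvPolynomial.induction_on with
    | C a =>
      have ha : blockProj I (C a) = algebraMap ℝ _ a := by simp [blockProj, algebraMap_eq]
      rw [ha]
      exact Subalgebra.algebraMap_mem _ a
    | add f g hf hg => rw [map_add]; exact add_mem hf hg
    | mul_X f l hf =>
      rw [map_mul]
      refine mul_mem hf ?_
      simp only [blockProj, aeval_X]
      split_ifs with hl
      · exact X_mem_supported.2 hl
      · exact zero_mem _
  exact_mod_cast mem_supported.1 this

theorem blockProj_eq_self {n : ℕ} {I : Finset (Fin n)} {f : MvPolynomial (Fin n) ℝ}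
    (hf : f.vars ⊆ I) : blockProj I f = f := by
  have : blockProj I f = aeval X f :=
    eval₂Hom_congr' rfl (fun l hl _ => by simp [hf hl]) rfl
  rw [this, aeval_X_left_apply]

theorem blockProj_X_of_notMem {n : ℕ} {I : Finset (Fin n)} {l : Fin n} (hl : l ∉ I) :
    blockProj I (X l) = 0 := by
  simp [blockProj, hl]

namespace SparseProblem

variable {n N m : ℕ} {P : SparseProblem n N m}

/-- The compact set of all points of the box `x_l² ≤ M` which satisfy the constraints of the
block `i`. -/
def blockBox (P : SparseProblem n N m) (i : Fin N) : Set (Fin n → ℝ) :=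
  {x | (∀ c ∈ P.J i, 0 ≤ eval x (P.con c)) ∧ ∀ l, x l * x l ≤ P.M}

theorem isCompact_blockBox (P : SparseProblem n N m) (i : Fin N) : IsCompact (P.blockBox i) := by
  have hclosed : IsClosed (P.blockBox i) := by
    simp only [blockBox, Set.ofPred_and, Set.ofPred_forall]
    refine IsClosed.inter ?_ ?_
    · exact isClosed_iInter fun c => isClosed_iInter fun _ =>
        isClosed_le continuous_const (continuous_eval _)
    · exact isClosed_iInter fun l => isClosed_le (by fun_prop) continuous_const
  refine (isCompact_univ_pi (s := fun _ : Fin n => Set.Icc (-√P.M) √P.M)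
    fun _ => isCompact_Icc).of_isClosed_subset hclosed fun x hx l _ => ?_
  exact abs_le.1 (Real.abs_le_sqrt (by simpa [sq] using hx.2 l))

/-- If every relaxation has a feasible point of objective value at most `c`, then the normalized
Riesz functionals `L_{y_i} / L_{y_i}(1)` have limit points `Λ_i` which are nonnegative on the
polynomials nonnegative on the block, and inherit the coupling conditions and the bound on the
objective in homogeneous form. -/
theorem exists_limit_functionals (hcv : ∀ i, ∀ c ∈ P.J i, (P.con c).vars ⊆ P.I i)
    (hJball : ∀ i, Sum.inr i ∈ P.J i) (hM : 0 < P.M) (hp : ∀ i, (P.p i).vars ⊆ P.I i)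
    (hq : ∀ i, (P.q i).vars ⊆ P.I i)
    (hqpos : ∀ i, ∀ z ∈ P.blockK i, 0 < eval (extendZero z) (P.q i)) {c : ℝ}
    (y : ℕ → Fin N → (Fin n →₀ ℕ) → ℝ) (hy : ∀ k, P.IsFeasible k (y k))
    (hyc : ∀ k, P.relaxObjective (y k) ≤ c) :
    ∃ Λ : Fin N → MvPolynomial (Fin n) ℝ →ₗ[ℝ] ℝ,
      (∀ i f, (∀ x ∈ P.blockBox i, 0 ≤ eval x f) → 0 ≤ Λ i f) ∧
      (∀ i, 0 < Λ i (P.q i)) ∧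
      (∀ i j, i < j → (P.I i ∩ P.I j).Nonempty → ∀ α : Fin n →₀ ℕ, α.support ⊆ P.I i ∩ P.I j →
        Λ i (monomial α 1 * P.q i) / Λ i (P.q i) = Λ j (monomial α 1 * P.q j) / Λ j (P.q j)) ∧
      ∑ i, Λ i (P.p i) / Λ i (P.q i) ≤ c := by
  let 𝒰 : Ultrafilter ℕ := Filter.hyperfilter ℕ
  have hU : ∀ k₀ : ℕ, ∀ᶠ k in (𝒰 : Filter ℕ), k₀ ≤ k := fun k₀ =>
    (Filter.eventually_ge_atTop k₀).filter_mono
      (Nat.hyperfilter_le_atTop)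
  have hpos : ∀ i, ∀ᶠ k in (𝒰 : Filter ℕ), 0 < y k i 0 := fun i =>
    (hU (P.q i).totalDegree).mono fun k hk =>
      (hy k).apply_zero_pos (hJball i) hM (support_subset_monos_iff.2 ⟨hq i, hk⟩)
  let F : Fin N → ℕ → MvPolynomial (Fin n) ℝ →ₗ[ℝ] ℝ := fun i k =>
    (y k i 0)⁻¹ • (rieszLin (y k i) ∘ₗ (blockProj (P.I i)).toLinearMap)
  have hF : ∀ i k f, F i k f = (y k i 0)⁻¹ * rieszL (y k i) (blockProj (P.I i) f) := fun i k f => by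
    rw [rieszL_eq]; rfl
  have hbound : ∀ i f, ∃ B : ℝ, ∀ᶠ k in (𝒰 : Filter ℕ), |F i k f| ≤ B := by
    intro i f
    refine ⟨∑ α ∈ (blockProj (P.I i) f).support,
      |(blockProj (P.I i) f).coeff α| * (P.M + 1) ^ α.degree, ?_⟩
    filter_upwards [hpos i, hU (blockProj (P.I i) f).totalDegree] with k hk hd
    have h := (hy k).abs_rieszL_le (hJball i) hM
      (support_subset_monos_iff.2 ⟨vars_blockProj (P.I i) f, hd⟩)
    rw [hF, abs_mul, abs_inv, abs_of_pos hk, ← div_eq_inv_mul, div_le_iff₀ hk, mul_comm]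
    exact h
  choose Λ hΛ using fun i => exists_linear_ultralimit 𝒰 (F i) (hbound i)
  have hFself : ∀ i k f, f.vars ⊆ P.I i → F i k f = (y k i 0)⁻¹ * rieszL (y k i) f :=
    fun i k f hf => by rw [hF, blockProj_eq_self hf]
  have hone : ∀ i, Λ i 1 = 1 := by
    intro i
    refine tendsto_nhds_unique (hΛ i 1) (tendsto_const_nhds.congr' ?_)
    filter_upwards [hpos i] with k hk
    have h1 : rieszL (y k i) 1 = y k i 0 := by
      rw [rieszL_eq, ← C_1, C_apply, rieszLin_monomial, one_mul]
    rw [hF, map_one, h1, inv_mul_cancel₀ hk.ne']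
  have hproj : ∀ i f, blockProj (P.I i) f = 0 → Λ i f = 0 := by
    intro i f hf
    refine tendsto_nhds_unique (hΛ i f) (tendsto_const_nhds.congr fun k => ?_)
    rw [hF, hf, rieszL_eq, map_zero, mul_zero]
  have hsq : ∀ i h, 0 ≤ Λ i (h * h) := by
    intro i h
    refine ge_of_tendsto (hΛ i (h * h)) ?_
    filter_upwards [hpos i, hU (blockProj (P.I i) h).totalDegree] with k hk hd
    rw [hF, map_mul]
    exact mul_nonneg (inv_nonneg.2 hk.le) ((momentMatrix_posSemidef_iff _ _ _).1 ((hy k).moment i) _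
      (support_subset_monos_iff.2 ⟨vars_blockProj _ h, hd⟩))
  have hloc : ∀ i, ∀ c ∈ P.J i, ∀ h, 0 ≤ Λ i (h * h * P.con c) := by
    intro i c hc h
    refine ge_of_tendsto (hΛ i _) ?_
    filter_upwards [hpos i, hU ((blockProj (P.I i) h).totalDegree + P.halfDeg c)] with k hk hd
    rw [hF, map_mul, map_mul, blockProj_eq_self (hcv i c hc)]
    exact mul_nonneg (inv_nonneg.2 hk.le) ((localizingMatrix_posSemidef_iff _ _ _ _).1
      ((hy k).localizing i c hc) _ (support_subset_monos_iff.2 ⟨vars_blockProj _ h, by omega⟩))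
  have hbox : ∀ i l h, 0 ≤ Λ i (h * h * (C P.M - X l * X l)) := by
    intro i l h
    by_cases hl : l ∈ P.I i
    · have he : h * h * (C P.M - X l * X l) = h * h * P.con (Sum.inr i) +
          ∑ l' ∈ (P.I i).erase l, (h * X l') * (h * X l') := by
        have h1 : ∑ l' ∈ (P.I i).erase l, (h * X l') * (h * X l')
            = h * h * ∑ l' ∈ (P.I i).erase l, X l' ^ 2 := by
          rw [Finset.mul_sum]
          exact Finset.sum_congr rfl fun l' _ => by ring
        rw [h1, con, ← Finset.add_sum_erase _ _ hl]
        ring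
      rw [he, map_add, map_sum]
      exact add_nonneg (hloc i _ (hJball i) h) (Finset.sum_nonneg fun l' _ => hsq i _)
    · have h0 : Λ i (h * h * (X l * X l)) = 0 := hproj i _ (by
        rw [map_mul, map_mul _ (X l), blockProj_X_of_notMem hl, mul_zero, mul_zero])
      have he : h * h * C P.M = P.M • (h * h) := by rw [smul_eq_C_mul, mul_comm]
      rw [mul_sub, map_sub, h0, sub_zero, he, map_smul]
      exact mul_nonneg hM.le (hsq i h)
  have hnonneg : ∀ i f, (∀ x ∈ P.blockBox i, 0 ≤ eval x f) → 0 ≤ Λ i f := by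
    intro i f hf
    refine apply_nonneg_of_localizing (G := P.con '' (P.J i) ∪ Set.range fun l => C P.M - X l * X l)
      (hsq i) ?_ (fun l => ⟨P.M, hM.le, hbox i l⟩) fun x hx => ?_
    · rintro _ (⟨c, hc, rfl⟩ | ⟨l, rfl⟩) h
      · exact hloc i c hc h
      · exact hbox i l h
    · refine hf x ⟨fun c hc => hx _ (Or.inl ⟨c, hc, rfl⟩), fun l => ?_⟩
      have := hx _ (Or.inr ⟨l, rfl⟩)
      simpa using this
  have hqbox : ∀ i, ∀ x ∈ P.blockBox i, 0 < eval x (P.q i) := fun i x hx => by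
    have := hqpos i _ ((restrict_mem_blockK hcv).2 hx.1)
    rwa [eval_extendZero_restrict (hq i)] at this
  -- On the compact block the denominator is bounded away from zero, so the normalizing constants
  -- stay away from zero in the limit.
  have hΛq : ∀ i, 0 < Λ i (P.q i) := by
    intro i
    obtain ⟨ε, hε, hle⟩ : ∃ ε : ℝ, 0 < ε ∧ ∀ x ∈ P.blockBox i, ε ≤ eval x (P.q i) := by
      rcases (P.blockBox i).eq_empty_or_nonempty with he | hne
      · exact ⟨1, one_pos, fun x hx => absurd (he ▸ hx) (Set.notMem_empty x)⟩
      · obtain ⟨x₀, hx₀, hmin⟩ := (P.isCompact_blockBox i).exists_isMinOn hne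
          (continuous_eval (P.q i)).continuousOn
        exact ⟨_, hqbox i x₀ hx₀, fun x hx => hmin hx⟩
    have := hnonneg i (P.q i - ε • 1) fun x hx => by
      rw [map_sub, smul_eval, map_one, mul_one]
      exact sub_nonneg.2 (hle x hx)
    rw [map_sub, map_smul, hone, smul_eq_mul, mul_one] at this
    linarith
  have hFq : ∀ i k, F i k (P.q i) = (y k i 0)⁻¹ := fun i k => by
    rw [hFself i k _ (hq i), (hy k).normalized, mul_one]
  refine ⟨Λ, hnonneg, hΛq, fun i j hij hne α hα => ?_, ?_⟩
  · have hvars : ∀ i' : Fin N, P.I i ∩ P.I j ⊆ P.I i' →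
        (monomial α (1 : ℝ) * P.q i').vars ⊆ P.I i' := by
      intro i' hi'
      refine (vars_mul _ _).trans (Finset.union_subset ?_ (hq i'))
      rw [vars_monomial one_ne_zero]
      exact hα.trans hi'
    have ht : ∀ i, Filter.Tendsto (fun k => F i k (monomial α 1 * P.q i) / F i k (P.q i)) 𝒰
        (nhds (Λ i (monomial α 1 * P.q i) / Λ i (P.q i))) := fun i =>
      (hΛ i _).div (hΛ i _) (hΛq i).ne'
    refine tendsto_nhds_unique (ht i) ((ht j).congr' ?_)
    filter_upwards [hpos i, hpos j,
      hU (α.degree + max (P.q i).totalDegree (P.q j).totalDegree)] with k hki hkj hd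
    rw [hFq, hFq, hFself _ _ _ (hvars i Finset.inter_subset_left),
      hFself _ _ _ (hvars j Finset.inter_subset_right),
      mul_div_cancel_left₀ _ (inv_ne_zero hki.ne'), mul_div_cancel_left₀ _ (inv_ne_zero hkj.ne')]
    exact ((hy k).coupling i j hij hne α hα (by omega)).symm
  · have ht : Filter.Tendsto (fun k => ∑ i, F i k (P.p i) / F i k (P.q i)) 𝒰
        (nhds (∑ i, Λ i (P.p i) / Λ i (P.q i))) :=
      tendsto_finsetSum _ fun i _ => (hΛ i _).div (hΛ i _) (hΛq i).ne'
    refine le_of_tendsto ht ?_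
    filter_upwards [Filter.eventually_all.2 hpos] with k hk
    refine le_of_eq_of_le (Finset.sum_congr rfl fun i _ => ?_) (hyc k)
    rw [hFq, hFself _ _ _ (hp i), mul_div_cancel_left₀ _ (inv_ne_zero (hk i).ne')]

end SparseProblem

/-! ### Convergence of the relaxations -/

section

open MeasureTheory

theorem continuous_extendZero {n : ℕ} {I : Finset (Fin n)} :
    Continuous (extendZero : (I → ℝ) → Fin n → ℝ) := by
  refine continuous_pi fun l => ?_
  by_cases hl : l ∈ I
  · simpa [extendZero, hl] using continuous_apply _
  · simpa [extendZero, hl] using continuous_const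

theorem ae_map_mem_iff {Ω Z : Type*} [MeasurableSpace Ω] [MeasurableSpace Z] {μ : Measure Ω}
    {f : Ω → Z} (hf : Measurable f) {S : Set Z} (hS : MeasurableSet S) :
    (∀ᵐ z ∂μ.map f, z ∈ S) ↔ ∀ᵐ x ∂μ, f x ∈ S :=
  ae_map_iff hf.aemeasurable hS

/-- The measure with density `q / ∫ q dμ` with respect to `μ` is a probability measure. -/
theorem exists_weighted_measure {Ω : Type*} [MeasurableSpace Ω] (μ : Measure Ω)
    [IsFiniteMeasure μ] {K : Set Ω} (hμ : μ Kᶜ = 0) {q : Ω → ℝ} (hq : Measurable q)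
    (hqi : Integrable q μ) (hqpos : ∀ x ∈ K, 0 ≤ q x) (hs : 0 < ∫ x, q x ∂μ) :
    ∃ ν : Measure Ω, IsProbabilityMeasure ν ∧ ν Kᶜ = 0 ∧
      ∀ f : Ω → ℝ, ∫ x, f x ∂ν = (∫ x, f x * q x ∂μ) / ∫ x, q x ∂μ := by
  set s := ∫ x, q x ∂μ
  set d : Ω → ENNReal := fun x => ENNReal.ofReal (q x / s)
  have hd : Measurable d := (hq.div_const s).ennreal_ofReal
  have hK : ∀ᵐ x ∂μ, x ∈ K := hμ
  have hae : ∀ᵐ x ∂μ, 0 ≤ q x / s := hK.mono fun x hx => div_nonneg (hqpos x hx) hs.le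
  refine ⟨μ.withDensity d, ⟨?_⟩, withDensity_absolutelyContinuous μ d hμ, fun f => ?_⟩
  · rw [withDensity_apply _ MeasurableSet.univ, Measure.restrict_univ,
      ← ofReal_integral_eq_lintegral_ofReal (hqi.div_const s) hae, integral_div,
      div_self hs.ne', ENNReal.ofReal_one]
  · rw [integral_withDensity_eq_integral_toReal_smul hd
      (Filter.Eventually.of_forall fun x => ENNReal.ofReal_lt_top), ← integral_div]
    refine integral_congr_ae (hae.mono fun x hx => ?_)
    simp only [d, smul_eq_mul, ENNReal.toReal_ofReal hx]
    ring

namespace SparseProblem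

variable {n N m : ℕ} {P : SparseProblem n N m}

theorem isClosed_blockK (P : SparseProblem n N m) (i : Fin N) : IsClosed (P.blockK i) := by
  simp only [blockK, Set.ofPred_forall]
  exact isClosed_iInter fun c => isClosed_iInter fun _ =>
    isClosed_le continuous_const ((continuous_eval _).comp continuous_extendZero)

/-- Functionals as in `exists_limit_functionals` are represented by measures on the blocks. The
weighted measures `q_i / Λ_i(q_i)` times these have common marginals, and can be glued to one
probability measure on `K`, against which the objective has the integral
`∑ i, Λ_i(p_i) / Λ_i(q_i)`. -/
theorem exists_measure_of_functionals (hcv : ∀ i, ∀ c ∈ P.J i, (P.con c).vars ⊆ P.I i)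
    (hJ : ∀ c, ∃! i, c ∈ P.J i) (hp : ∀ i, (P.p i).vars ⊆ P.I i)
    (hq : ∀ i, (P.q i).vars ⊆ P.I i)
    (hqpos : ∀ i, ∀ z ∈ P.blockK i, 0 < eval (extendZero z) (P.q i))
    (hrip : P.RunningIntersection) {Λ : Fin N → MvPolynomial (Fin n) ℝ →ₗ[ℝ] ℝ}
    (hΛ : ∀ i f, (∀ x ∈ P.blockBox i, 0 ≤ eval x f) → 0 ≤ Λ i f)
    (hΛq : ∀ i, 0 < Λ i (P.q i))
    (hcoup : ∀ i j, i < j → (P.I i ∩ P.I j).Nonempty → ∀ α : Fin n →₀ ℕ,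
      α.support ⊆ P.I i ∩ P.I j →
        Λ i (monomial α 1 * P.q i) / Λ i (P.q i) = Λ j (monomial α 1 * P.q j) / Λ j (P.q j)) :
    ∃ π : Measure (Fin n → ℝ), IsProbabilityMeasure π ∧ (∀ᵐ x ∂π, x ∈ P.K) ∧
      Integrable P.objective π ∧
      ∫ x, P.objective x ∂π = ∑ i, Λ i (P.p i) / Λ i (P.q i) := by
  choose μ hμfin hμK hμ using fun i =>
    exists_measure_of_nonneg_on_compact (P.isCompact_blockBox i) (hΛ i)
  have hqbox : ∀ i, ∀ x ∈ P.blockBox i, 0 < eval x (P.q i) := fun i x hx => by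
    have := hqpos i _ ((restrict_mem_blockK hcv).2 hx.1)
    rwa [eval_extendZero_restrict (hq i)] at this
  have hmeas : ∀ f : MvPolynomial (Fin n) ℝ, Measurable fun x : Fin n → ℝ => eval x f :=
    fun f => (continuous_eval f).measurable
  choose ν hνprob hνK hν using fun i => exists_weighted_measure (μ i) (hμK i) (hmeas (P.q i))
    (integrable_of_continuousOn_compact (P.isCompact_blockBox i) (hμK i) (hmeas (P.q i))
      (continuous_eval _).continuousOn)
    (fun x hx => (hqbox i x hx).le) (by rw [hμ]; exact hΛq i)
  have hνpoly : ∀ i f, ∫ x, eval x f ∂ν i = Λ i (f * P.q i) / Λ i (P.q i) := by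
    intro i f
    rw [hν, hμ]
    congr 1
    rw [← hμ i (f * P.q i)]
    simp only [map_mul]
  have hae : ∀ i, ∀ᵐ x ∂ν i, x ∈ P.blockBox i := hνK
  have hmarg : ∀ i j, j < i → (ν j).map (P.I i ∩ P.I j).restrict
      = (ν i).map (P.I i ∩ P.I j).restrict := by
    intro i j hji
    rcases (P.I i ∩ P.I j).eq_empty_or_nonempty with he | hne
    · rw [he]
      exact map_restrict_empty_eq _ _
    · set T := P.I i ∩ P.I j with hT
      have hbox : IsCompact {z : T → ℝ | ∀ l, z l * z l ≤ P.M} := by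
        refine (isCompact_univ_pi (s := fun _ : T => Set.Icc (-√P.M) √P.M)
          fun _ => isCompact_Icc).of_isClosed_subset ?_ fun z hz l _ => ?_
        · simp only [Set.ofPred_forall]
          exact isClosed_iInter fun l => isClosed_le (by fun_prop) continuous_const
        · exact abs_le.1 (Real.abs_le_sqrt (by simpa [sq] using hz l))
      have hcarried : ∀ i', (ν i').map T.restrict {z : T → ℝ | ∀ l, z l * z l ≤ P.M}ᶜ = 0 := by
        intro i'
        have : ∀ᵐ z ∂(ν i').map T.restrict, z ∈ {z : T → ℝ | ∀ l, z l * z l ≤ P.M} := by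
          rw [ae_map_mem_iff (by fun_prop) hbox.measurableSet]
          exact (hae i').mono fun x hx l => hx.2 l.1
        exact this
      have hprob : ∀ i', IsProbabilityMeasure ((ν i').map (T.restrict (π := fun _ => ℝ))) :=
        fun i' => Measure.isProbabilityMeasure_map (by fun_prop)
      refine measure_eq_of_forall_integral_monomial_eq hbox (hcarried j) (hcarried i) fun α => ?_
      have hint : ∀ i', ∫ z, eval z (monomial α (1 : ℝ)) ∂(ν i').map T.restrict
          = Λ i' (monomial (α.mapDomain Subtype.val) 1 * P.q i') / Λ i' (P.q i') := by
        intro i'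
        rw [integral_map (by fun_prop) (continuous_eval _).aestronglyMeasurable, ← hνpoly,
          ← rename_monomial]
        simp only [eval_rename]
        rfl
      rw [hint, hint]
      refine hcoup j i hji ?_ _ ?_
      · rwa [Finset.inter_comm]
      · classical
        refine Finsupp.mapDomain_support.trans fun l hl => ?_
        obtain ⟨l', -, rfl⟩ := Finset.mem_image.1 hl
        rw [Finset.inter_comm]
        exact l'.2
  obtain ⟨π, hπ, hπν⟩ := exists_measure_of_running_intersection P.I hrip ν hmarg
  have hblock : ∀ i, ∀ᵐ x : Fin n → ℝ ∂π, (P.I i).restrict x ∈ P.blockK i := by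
    intro i
    have hr : Measurable ((P.I i).restrict : (Fin n → ℝ) → P.I i → ℝ) := by fun_prop
    have hm := (P.isClosed_blockK i).measurableSet
    rw [← ae_map_mem_iff hr hm, hπν i, ae_map_mem_iff hr hm]
    exact (hae i).mono fun x hx => (restrict_mem_blockK hcv).2 hx.1
  -- The ratio `p_i / q_i` factors through the block `i`, so its integral can be computed there.
  set G : ∀ i, (P.I i → ℝ) → ℝ := fun i z =>
    eval (extendZero z) (P.p i) / eval (extendZero z) (P.q i)
  have hG : ∀ i x, G i ((P.I i).restrict x) = eval x (P.p i) / eval x (P.q i) := fun i x => by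
    simp only [G]
    rw [eval_extendZero_restrict (hp i), eval_extendZero_restrict (hq i)]
  have hGm : ∀ i, Measurable (G i) := fun i =>
    ((continuous_eval _).comp continuous_extendZero).measurable.div
      ((continuous_eval _).comp continuous_extendZero).measurable
  have hint : ∀ i, Integrable (fun x => eval x (P.p i) / eval x (P.q i)) π := by
    intro i
    have h1 : Integrable (fun x => eval x (P.p i) / eval x (P.q i)) (ν i) :=
      integrable_of_continuousOn_compact (P.isCompact_blockBox i) (hνK i)
        ((hmeas _).div (hmeas _)) ((continuous_eval _).continuousOn.div
          (continuous_eval _).continuousOn fun x hx => (hqbox i x hx).ne')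
    simp only [← hG] at h1 ⊢
    have h2 : Integrable (G i) ((ν i).map (P.I i).restrict) :=
      (integrable_map_measure (hGm i).aestronglyMeasurable (by fun_prop)).2 h1
    rw [← hπν i] at h2
    exact (integrable_map_measure (hGm i).aestronglyMeasurable (by fun_prop)).1 h2
  have hval : ∀ i, ∫ x, eval x (P.p i) / eval x (P.q i) ∂π = Λ i (P.p i) / Λ i (P.q i) := by
    intro i
    calc ∫ x, eval x (P.p i) / eval x (P.q i) ∂π
        = ∫ z, G i z ∂π.map (P.I i).restrict := by
          rw [integral_map (by fun_prop) (hGm i).aestronglyMeasurable]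
          simp only [hG]
      _ = ∫ x, eval x (P.p i) / eval x (P.q i) ∂ν i := by
          rw [hπν i, integral_map (by fun_prop) (hGm i).aestronglyMeasurable]
          simp only [hG]
      _ = Λ i (P.p i) / Λ i (P.q i) := by
          rw [hν, hμ]
          congr 1
          rw [← hμ i (P.p i)]
          refine integral_congr_ae ?_
          filter_upwards [show ∀ᵐ x ∂μ i, x ∈ P.blockBox i from hμK i] with x hx
          exact div_mul_cancel₀ _ (hqbox i x hx).ne'
  refine ⟨π, hπ, ?_, integrable_finsetSum _ fun i _ => hint i, ?_⟩
  · filter_upwards [ae_all_iff.2 hblock] with x hx using mem_K_of_restrict_mem_blockK hcv hJ hx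
  · simp only [objective]
    rw [integral_finsetSum _ fun i _ => hint i]
    exact Finset.sum_congr rfl fun i _ => hval i

theorem tendsto_relaxVal (hcv : ∀ i, ∀ c ∈ P.J i, (P.con c).vars ⊆ P.I i)
    (hJ : ∀ c, ∃! i, c ∈ P.J i) (hJball : ∀ i, Sum.inr i ∈ P.J i) (hM : 0 < P.M)
    (hKM : ∀ x ∈ P.K, ∑ l, x l ^ 2 ≤ P.M) (hp : ∀ i, (P.p i).vars ⊆ P.I i)
    (hq : ∀ i, (P.q i).vars ⊆ P.I i)
    (hqpos : ∀ i, ∀ z ∈ P.blockK i, 0 < eval (extendZero z) (P.q i))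
    (hrip : P.RunningIntersection) :
    Filter.Tendsto P.relaxVal Filter.atTop (nhds P.optVal) := by
  have hlim := tendsto_atTop_iSup P.relaxVal_mono
  have hsup : ⨆ k, P.relaxVal k = P.optVal := by
    refine le_antisymm (iSup_le fun k => relaxVal_le_optVal hcv hKM hq hqpos k) ?_
    by_contra! hlt
    obtain ⟨c, hc, hlt'⟩ := EReal.lt_iff_exists_real_btwn.1 hlt
    obtain ⟨c', hcc', hc'⟩ := EReal.lt_iff_exists_real_btwn.1 hlt'
    have hex : ∀ k, ∃ y, P.IsFeasible k y ∧ P.relaxObjective y ≤ c := by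
      intro k
      have hk : P.relaxVal k < c := (le_iSup P.relaxVal k).trans_lt hc
      obtain ⟨y, hy⟩ := iInf_lt_iff.1 hk
      obtain ⟨hfeas, hobj⟩ := iInf_lt_iff.1 hy
      exact ⟨y, hfeas, (EReal.coe_lt_coe_iff.1 hobj).le⟩
    choose y hy hyc using hex
    obtain ⟨Λ, hΛ, hΛq, hcoup, hobj⟩ :=
      exists_limit_functionals hcv hJball hM hp hq hqpos y hy hyc
    obtain ⟨π, hπ, hπK, hint, hval⟩ :=
      exists_measure_of_functionals hcv hJ hp hq hqpos hrip hΛ hΛq hcoup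
    have hle : c' ≤ ∫ x, P.objective x ∂π := by
      have h1 : ∫ _, c' ∂π ≤ ∫ x, P.objective x ∂π := by
        refine integral_mono_ae (integrable_const c') hint ?_
        filter_upwards [hπK] with x hx
        exact EReal.coe_le_coe_iff.1 (hc'.le.trans (iInf₂_le x hx))
      simpa using h1
    have : c < c' := EReal.coe_lt_coe_iff.1 hcc'
    linarith
  rwa [hsup] at hlim

end SparseProblem

end

/-! ### Optimal solutions with flat moment matrices -/

theorem rieszL_eq_sum_atoms {n : ℕ} {y : (Fin n →₀ ℕ) → ℝ} {I : Finset (Fin n)} {d : ℕ}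
    {Δ : Finset (I → ℝ)} {w : (I → ℝ) → ℝ}
    (hy : ∀ α ∈ monos I d, y α = ∑ z ∈ Δ, w z * eval (extendZero z) (monomial α 1))
    {f : MvPolynomial (Fin n) ℝ} (hf : f.support ⊆ monos I d) :
    rieszL y f = ∑ z ∈ Δ, w z * eval (extendZero z) f := by
  have h1 : ∀ z : I → ℝ, eval (extendZero z) f
      = ∑ α ∈ f.support, f.coeff α * eval (extendZero z) (monomial α 1) :=
    fun z => (rieszL_eval (extendZero z) f).symm
  simp only [h1, rieszL, Finset.mul_sum]
  rw [Finset.sum_comm]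
  refine Finset.sum_congr rfl fun α hα => ?_
  rw [hy α (hf hα), Finset.mul_sum]
  exact Finset.sum_congr rfl fun z _ => by ring

namespace SparseProblem

variable {n N m : ℕ} {P : SparseProblem n N m}

theorem con_support_subset (hcv : ∀ i, ∀ c ∈ P.J i, (P.con c).vars ⊆ P.I i) {i : Fin N}
    {c : Fin m ⊕ Fin N} (hc : c ∈ P.J i) :
    (P.con c).support ⊆ monos (P.I i) (2 * P.halfDeg c) :=
  support_subset_monos_iff.2 ⟨hcv i c hc, P.totalDegree_con_le c⟩

theorem monomial_mul_q_support_subset (hq : ∀ i, (P.q i).vars ⊆ P.I i) {i : Fin N} {k d : ℕ}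
    {α : Fin n →₀ ℕ} (hα : α.support ⊆ P.I i) (hd : (P.q i).totalDegree ≤ d)
    (hk : α.degree + d ≤ 2 * k) :
    (monomial α (1 : ℝ) * P.q i).support ⊆ monos (P.I i) (2 * k) :=
  (mul_support_subset_monos
    (monomial_support_subset_monos (mem_monos.2 ⟨hα, le_refl α.degree⟩) (1 : ℝ))
    (support_subset_monos_iff.2 ⟨hq i, hd⟩)).trans (monos_mono le_rfl hk)

/-- Feasibility in the relaxation of order `k` only depends on the moments of degree at most `2k`
in the variables of the blocks. -/
theorem IsFeasible.congr (hcv : ∀ i, ∀ c ∈ P.J i, (P.con c).vars ⊆ P.I i)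
    (hq : ∀ i, (P.q i).vars ⊆ P.I i) {k : ℕ} (hk : P.Admissible k)
    {y y' : Fin N → (Fin n →₀ ℕ) → ℝ} (h : P.IsFeasible k y)
    (hyy' : ∀ i, ∀ α ∈ monos (P.I i) (2 * k), y i α = y' i α) : P.IsFeasible k y' := by
  have hL : ∀ i (f : MvPolynomial (Fin n) ℝ), f.support ⊆ monos (P.I i) (2 * k) →
      rieszL (y i) f = rieszL (y' i) f := fun i f hf =>
    rieszL_congr fun α hα => hyy' i α (hf hα)
  refine ⟨fun i => ?_, fun i c hc => ?_, fun i => ?_, fun i j hij hne α hα hd => ?_⟩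
  · rw [momentMatrix_posSemidef_iff]
    intro f hf
    rw [← hL i _ ((mul_support_subset_monos hf hf).trans (monos_mono le_rfl (by omega)))]
    exact (momentMatrix_posSemidef_iff _ _ _).1 (h.moment i) f hf
  · rw [localizingMatrix_posSemidef_iff]
    intro f hf
    have := hk.2 c
    rw [← hL i _ ((mul_support_subset_monos (mul_support_subset_monos hf hf)
      (con_support_subset hcv hc)).trans (monos_mono le_rfl (by omega)))]
    exact (localizingMatrix_posSemidef_iff _ _ _ _).1 (h.localizing i c hc) f hf
  · rw [← hL i _ (support_subset_monos_iff.2 ⟨hq i, hk.1 i⟩), h.normalized]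
  · rw [← hL i _ (monomial_mul_q_support_subset hq (hα.trans Finset.inter_subset_left)
        (le_max_left _ _) hd),
      ← hL j _ (monomial_mul_q_support_subset hq (hα.trans Finset.inter_subset_right)
        (le_max_right _ _) hd)]
    exact h.coupling i j hij hne α hα hd

/-- If the relaxation of order `k` has an optimal solution, then no numerator has degree greater
than `2k`, since the moments of higher degree are unconstrained. -/
theorem IsOptimal.p_support_subset (hcv : ∀ i, ∀ c ∈ P.J i, (P.con c).vars ⊆ P.I i)
    (hp : ∀ i, (P.p i).vars ⊆ P.I i) (hq : ∀ i, (P.q i).vars ⊆ P.I i) {k : ℕ}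
    (hk : P.Admissible k) {y : Fin N → (Fin n →₀ ℕ) → ℝ} (h : P.IsOptimal k y) (i : Fin N) :
    (P.p i).support ⊆ monos (P.I i) (2 * k) := by
  classical
  by_contra hnot
  obtain ⟨α, hα, hαm⟩ := Finset.not_subset.1 hnot
  have hαI : α.support ⊆ P.I i := fun l hl =>
    hp i ((mem_vars_iff_mem_support l).2 ⟨α, hα, hl⟩)
  set a := (P.p i).coeff α with ha
  have ha0 : a ≠ 0 := mem_support_iff.1 hα
  set y' : Fin N → (Fin n →₀ ℕ) → ℝ :=
    Function.update y i (Function.update (y i) α (y i α - a)) with hy'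
  have hfeas : P.IsFeasible k y' := by
    refine h.1.congr hcv hq hk fun i' β hβ => ?_
    rcases eq_or_ne i' i with rfl | hne
    · rw [hy', Function.update_self, Function.update_of_ne]
      rintro rfl
      exact hαm hβ
    · rw [hy', Function.update_of_ne hne]
  have hobj : P.relaxObjective y' = P.relaxObjective y - a * a := by
    have h1 : rieszL (y' i) (P.p i) = rieszL (y i) (P.p i) - a * a := by
      rw [hy', Function.update_self, rieszL, rieszL, ← Finset.add_sum_erase _ _ hα,
        ← Finset.add_sum_erase _ (fun β => (P.p i).coeff β * y i β) hα, Function.update_self]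
      have : ∑ β ∈ (P.p i).support.erase α, (P.p i).coeff β *
          Function.update (y i) α (y i α - a) β
          = ∑ β ∈ (P.p i).support.erase α, (P.p i).coeff β * y i β :=
        Finset.sum_congr rfl fun β hβ => by rw [Function.update_of_ne (Finset.ne_of_mem_erase hβ)]
      rw [this, ← ha]
      ring
    rw [relaxObjective, relaxObjective, ← Finset.add_sum_erase _ _ (Finset.mem_univ i),
      ← Finset.add_sum_erase _ (fun i => rieszL (y i) (P.p i)) (Finset.mem_univ i), h1]
    have : ∑ i' ∈ Finset.univ.erase i, rieszL (y' i') (P.p i')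
        = ∑ i' ∈ Finset.univ.erase i, rieszL (y i') (P.p i') :=
      Finset.sum_congr rfl fun i' hi' => by
        rw [hy', Function.update_of_ne (Finset.ne_of_mem_erase hi')]
    rw [this]
    ring
  have hle := h.2 y' hfeas
  rw [hobj] at hle
  have : 0 < a * a := mul_self_pos.2 ha0
  linarith

theorem blockHalfDeg_le {k : ℕ} (hk : P.Admissible k) (i : Fin N) : P.blockHalfDeg i ≤ k :=
  Finset.sup_le fun c _ => hk.2 c

theorem halfDeg_le_blockHalfDeg {i : Fin N} {c : Fin m ⊕ Fin N} (hc : c ∈ P.J i) :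
    P.halfDeg c ≤ P.blockHalfDeg i :=
  Finset.le_sup hc

/-- A flat moment matrix of a feasible point comes from a measure with finitely many atoms, which
satisfy the constraints of the block: evaluating a localizing form at the square of a polynomial
of low degree interpolating an atom gives the value of the constraint there. -/
theorem exists_atoms (hcv : ∀ i, ∀ c ∈ P.J i, (P.con c).vars ⊆ P.I i)
    (hJball : ∀ i, Sum.inr i ∈ P.J i) {k : ℕ} (hk : P.Admissible k)
    {y : Fin N → (Fin n →₀ ℕ) → ℝ} (h : P.IsFeasible k y) {i : Fin N}
    (hrank : (momentMatrix (y i) (P.I i) k).rank =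
      (momentMatrix (y i) (P.I i) (k - P.blockHalfDeg i)).rank) :
    ∃ (Δ : Finset (P.I i → ℝ)) (w : (P.I i → ℝ) → ℝ),
      Δ.card = (momentMatrix (y i) (P.I i) k).rank ∧ ↑Δ ⊆ P.blockK i ∧ (∀ z ∈ Δ, 0 < w z) ∧
      ∀ α ∈ monos (P.I i) (2 * k), y i α = ∑ z ∈ Δ, w z * eval (extendZero z) (monomial α 1) := by
  have hvk := blockHalfDeg_le hk i
  obtain ⟨Δ, w, hcard, hw, hy, hinterp⟩ := flat_extension (h.moment i)
    (Nat.sub_le k (P.blockHalfDeg i)) (fun hne => by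
      have := P.one_le_halfDeg_ball hne
      have := halfDeg_le_blockHalfDeg (hJball i)
      omega) hrank
  refine ⟨Δ, w, hcard, fun z hz c hc => ?_, hw, hy⟩
  obtain ⟨f, hf, hfz⟩ := hinterp z hz
  have hcv' := halfDeg_le_blockHalfDeg hc
  have hloc := (localizingMatrix_posSemidef_iff _ _ _ _).1 (h.localizing i c hc) f
    (hf.trans (monos_mono le_rfl (by omega)))
  rw [rieszL_eq_sum_atoms hy ((mul_support_subset_monos (mul_support_subset_monos hf hf)
    (con_support_subset hcv hc)).trans (monos_mono le_rfl (by omega))),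
    Finset.sum_eq_single_of_mem z hz (fun z' hz' hne => by
      rw [map_mul, map_mul, hfz z' hz', if_neg hne, zero_mul, zero_mul, mul_zero]),
    map_mul, map_mul, hfz z hz, if_pos rfl, one_mul, one_mul] at hloc
  exact (mul_nonneg_iff_of_pos_left (hw z hz)).1 hloc

end SparseProblem

/-- Equality in the Cauchy-Schwarz inequality for a function and a constant, with respect to
positive weights, forces the function to be constant. -/
theorem sum_mul_eq_of_sum_mul_sum_eq {ι : Type*} {s : Finset ι} {w f : ι → ℝ}
    (hw : ∀ z ∈ s, 0 < w z)
    (h : (∑ z ∈ s, w z) * ∑ z ∈ s, w z * (f z * f z)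
      = (∑ z ∈ s, w z * f z) * ∑ z ∈ s, w z * f z) {z : ι} (hz : z ∈ s) :
    (∑ z ∈ s, w z) * f z = ∑ z ∈ s, w z * f z := by
  set W := ∑ z ∈ s, w z with hW
  set F := ∑ z ∈ s, w z * f z with hF
  have hsum : ∑ z ∈ s, w z * (W * f z - F) ^ 2 = 0 := by
    have : ∀ z, w z * (W * f z - F) ^ 2
        = W ^ 2 * (w z * (f z * f z)) - 2 * W * F * (w z * f z) + F ^ 2 * w z := fun z => by ring
    simp only [this, Finset.sum_add_distrib, Finset.sum_sub_distrib, ← Finset.mul_sum, ← hW, ← hF]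
    linear_combination W * h
  have := (Finset.sum_eq_zero_iff_of_nonneg fun z hz =>
    mul_nonneg (hw z hz).le (sq_nonneg _)).1 hsum z hz
  have := (mul_eq_zero.1 this).resolve_left (hw z hz).ne'
  exact sub_eq_zero.1 (pow_eq_zero_iff two_ne_zero |>.1 this)

/-- If a weighted mean with positive weights of total mass one is at most every value, then all
values are equal to it. -/
theorem eq_of_sum_mul_le {ι : Type*} {s : Finset ι} {w f : ι → ℝ} (hw : ∀ z ∈ s, 0 < w z)
    (h1 : ∑ z ∈ s, w z = 1) (h : ∀ z ∈ s, ∑ z ∈ s, w z * f z ≤ f z) {z : ι} (hz : z ∈ s) :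
    f z = ∑ z ∈ s, w z * f z := by
  set E := ∑ z ∈ s, w z * f z with hE
  have hsum : ∑ z ∈ s, w z * (f z - E) = 0 := by
    simp only [mul_sub, Finset.sum_sub_distrib, ← Finset.sum_mul, h1, ← hE, one_mul, sub_self]
  have := (Finset.sum_eq_zero_iff_of_nonneg fun z hz =>
    mul_nonneg (hw z hz).le (sub_nonneg.2 (h z hz))).1 hsum z hz
  exact sub_eq_zero.1 ((mul_eq_zero.1 this).resolve_left (hw z hz).ne')

/-- A moment matrix of rank one forces the atoms of the measure to agree in each coordinate. -/
theorem atoms_coordinate_eq {n : ℕ} {y : (Fin n →₀ ℕ) → ℝ} {I T : Finset (Fin n)} {k : ℕ}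
    {Δ : Finset (I → ℝ)} {w : (I → ℝ) → ℝ} (hw : ∀ z ∈ Δ, 0 < w z)
    (hy : ∀ α ∈ monos I (2 * k), y α = ∑ z ∈ Δ, w z * eval (extendZero z) (monomial α 1))
    (hTI : T ⊆ I) (hk : 1 ≤ k) (hrank : (momentMatrix y T k).rank = 1) {l : Fin n} (hl : l ∈ T)
    {z z' : I → ℝ} (hz : z ∈ Δ) (hz' : z' ∈ Δ) : z ⟨l, hTI hl⟩ = z' ⟨l, hTI hl⟩ := by
  have h0 : (0 : Fin n →₀ ℕ) ∈ monos T k := zero_mem_monos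
  have h1 : Finsupp.single l 1 ∈ monos T k := mem_monos.2
    ⟨Finsupp.support_single_subset.trans (by simpa using hl), by simpa using hk⟩
  have hmem : ∀ {α β}, α ∈ monos T k → β ∈ monos T k → α + β ∈ monos I (2 * k) := fun hα hβ =>
    monos_mono hTI (by omega) (add_mem_monos hα hβ)
  have hX : ∀ z : I → ℝ, eval (extendZero z) (monomial (Finsupp.single l 1) 1) = z ⟨l, hTI hl⟩ :=
    fun z => by simp [eval_monomial, extendZero, hTI hl]
  have hminor := mul_eq_mul_of_momentMatrix_rank_eq_one hrank h0 h1
  rw [hy _ (hmem h0 h0), hy _ (hmem h0 h1), hy _ (hmem h1 h1)] at hminor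
  simp only [eval_monomial_add, hX, monomial_zero', map_one, one_mul, mul_one] at hminor
  have e := sum_mul_eq_of_sum_mul_sum_eq hw hminor hz
  have e' := sum_mul_eq_of_sum_mul_sum_eq hw hminor hz'
  have hpos : 0 < ∑ z ∈ Δ, w z := Finset.sum_pos hw ⟨z, hz⟩
  exact mul_left_cancel₀ hpos.ne' (e.trans e'.symm)

namespace SparseProblem

variable {n N m : ℕ} {P : SparseProblem n N m}

section Extraction

variable {k : ℕ} {y : Fin N → (Fin n →₀ ℕ) → ℝ} {Δ : ∀ i, Finset (P.I i → ℝ)}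
  {w : ∀ i, (P.I i → ℝ) → ℝ}

/-- The atoms of different blocks agree in the common coordinates: within a block they agree by
the rank condition, so the common value is the moment `L(x_l q_i)`, which is subject to the
coupling conditions. -/
theorem atoms_compatible (hq : ∀ i, (P.q i).vars ⊆ P.I i)
    (hk : P.Admissible k)
    (hkq : ∀ i j, i < j → (P.I i ∩ P.I j).Nonempty →
      max (P.q i).totalDegree (P.q j).totalDegree + 1 ≤ 2 * k)
    (h : P.IsFeasible k y)
    (hrank : ∀ i j, i < j → (P.I i ∩ P.I j).Nonempty →
      (momentMatrix (y i) (P.I i ∩ P.I j) k).rank = 1 ∧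
      (momentMatrix (y j) (P.I i ∩ P.I j) k).rank = 1)
    (hw : ∀ i, ∀ z ∈ Δ i, 0 < w i z)
    (hy : ∀ i, ∀ α ∈ monos (P.I i) (2 * k),
      y i α = ∑ z ∈ Δ i, w i z * eval (extendZero z) (monomial α 1))
    {i j : Fin N} (hij : i < j) {z : P.I i → ℝ} (hz : z ∈ Δ i) {z' : P.I j → ℝ} (hz' : z' ∈ Δ j)
    {l : Fin n} (hl : l ∈ P.I i) (hl' : l ∈ P.I j) : z ⟨l, hl⟩ = z' ⟨l, hl'⟩ := by
  have hlT : l ∈ P.I i ∩ P.I j := Finset.mem_inter.2 ⟨hl, hl'⟩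
  have hne : (P.I i ∩ P.I j).Nonempty := ⟨l, hlT⟩
  have hk1 : 1 ≤ k := (P.one_le_halfDeg_ball ⟨l, hl⟩).trans (hk.2 _)
  have hd := hkq i j hij hne
  have hsupp : (Finsupp.single l 1 : Fin n →₀ ℕ).support ⊆ P.I i ∩ P.I j :=
    Finsupp.support_single_subset.trans (by simpa using hlT)
  have hdeg : (Finsupp.single l 1 : Fin n →₀ ℕ).degree +
      max (P.q i).totalDegree (P.q j).totalDegree ≤ 2 * k := by
    rw [Finsupp.degree_single]
    omega
  have key : ∀ (i' : Fin N) (hT : P.I i ∩ P.I j ⊆ P.I i'),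
      (P.q i').totalDegree ≤ max (P.q i).totalDegree (P.q j).totalDegree →
      (momentMatrix (y i') (P.I i ∩ P.I j) k).rank = 1 → ∀ z ∈ Δ i',
      rieszL (y i') (monomial (Finsupp.single l 1) 1 * P.q i') = z ⟨l, hT hlT⟩ := by
    intro i' hT hq' hr z hz
    have hone := rieszL_eq_sum_atoms (hy i') (support_subset_monos_iff.2 ⟨hq i', hk.1 i'⟩)
    rw [h.normalized] at hone
    rw [rieszL_eq_sum_atoms (hy i')
      (monomial_mul_q_support_subset hq (hsupp.trans hT) hq' hdeg)]
    calc ∑ z' ∈ Δ i', w i' z' * eval (extendZero z') (monomial (Finsupp.single l 1) 1 * P.q i')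
        = ∑ z' ∈ Δ i', z ⟨l, hT hlT⟩ * (w i' z' * eval (extendZero z') (P.q i')) := by
          refine Finset.sum_congr rfl fun z' hz' => ?_
          rw [atoms_coordinate_eq (hw i') (hy i') hT hk1 hr hlT hz hz', map_mul]
          have : eval (extendZero z') (monomial (Finsupp.single l 1) (1 : ℝ)) = z' ⟨l, hT hlT⟩ := by
            simp [eval_monomial, extendZero, hT hlT]
          rw [this]
          ring
      _ = z ⟨l, hT hlT⟩ := by rw [← Finset.mul_sum, ← hone, mul_one]
  rw [← key i Finset.inter_subset_left (le_max_left _ _) (hrank i j hij hne).1 z hz,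
    ← key j Finset.inter_subset_right (le_max_right _ _) (hrank i j hij hne).2 z' hz']
  exact h.coupling i j hij hne _ hsupp hdeg

theorem exists_point_of_atoms (hcover : ∀ l, ∃ i, l ∈ P.I i)
    (hcompat : ∀ {i j}, i < j → ∀ {z}, z ∈ Δ i → ∀ {z'}, z' ∈ Δ j → ∀ {l} (hl : l ∈ P.I i)
      (hl' : l ∈ P.I j), z ⟨l, hl⟩ = z' ⟨l, hl'⟩)
    {z : ∀ i, P.I i → ℝ} (hz : ∀ i, z i ∈ Δ i) :
    ∃ x : Fin n → ℝ, ∀ i, (P.I i).restrict x = z i := by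
  choose b hb using hcover
  refine ⟨fun l => z (b l) ⟨l, hb l⟩, fun i => funext fun l => ?_⟩
  have key : ∀ j (hj : l.1 ∈ P.I j), z j ⟨l.1, hj⟩ = z i l := by
    intro j hj
    rcases lt_trichotomy j i with hlt | rfl | hlt
    · exact hcompat hlt (hz j) (hz i) hj l.2
    · rfl
    · exact (hcompat hlt (hz i) (hz j) l.2 hj).symm
  exact key _ (hb l.1)

/-- Every point assembled from the atoms has the objective value of the optimal solution. In each
block the ratio `p_i / q_i` has mean `L(p_i)` with respect to the weights `w_z q_i(z)`; a point
assembled from minimizers of the ratios lies in `K`, so its value is at least the sum of the means,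
and hence the ratios are constant on the atoms. -/
theorem IsOptimal.objective_eq (hcv : ∀ i, ∀ c ∈ P.J i, (P.con c).vars ⊆ P.I i)
    (hJ : ∀ c, ∃! i, c ∈ P.J i) (hKM : ∀ x ∈ P.K, ∑ l, x l ^ 2 ≤ P.M)
    (hp : ∀ i, (P.p i).vars ⊆ P.I i) (hq : ∀ i, (P.q i).vars ⊆ P.I i)
    (hqpos : ∀ i, ∀ z ∈ P.blockK i, 0 < eval (extendZero z) (P.q i)) (hk : P.Admissible k)
    (h : P.IsOptimal k y) (hΔK : ∀ i, ↑(Δ i) ⊆ P.blockK i) (hw : ∀ i, ∀ z ∈ Δ i, 0 < w i z)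
    (hy : ∀ i, ∀ α ∈ monos (P.I i) (2 * k),
      y i α = ∑ z ∈ Δ i, w i z * eval (extendZero z) (monomial α 1))
    (hpoint : ∀ z : ∀ i, P.I i → ℝ, (∀ i, z i ∈ Δ i) →
      ∃ x : Fin n → ℝ, ∀ i, (P.I i).restrict x = z i)
    (hne : ∀ i, (Δ i).Nonempty)
    {x : Fin n → ℝ} (hx : ∀ i, (P.I i).restrict x ∈ Δ i) :
    P.objective x = P.relaxObjective y := by
  set ρ : ∀ i, (P.I i → ℝ) → ℝ := fun i z =>
    eval (extendZero z) (P.p i) / eval (extendZero z) (P.q i) with hρ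
  set v : ∀ i, (P.I i → ℝ) → ℝ := fun i z => w i z * eval (extendZero z) (P.q i) with hv
  have hv0 : ∀ i, ∀ z ∈ Δ i, 0 < v i z := fun i z hz =>
    mul_pos (hw i z hz) (hqpos i z (hΔK i hz))
  have hv1 : ∀ i, ∑ z ∈ Δ i, v i z = 1 := fun i => by
    rw [← h.1.normalized i,
      rieszL_eq_sum_atoms (hy i) (support_subset_monos_iff.2 ⟨hq i, hk.1 i⟩)]
  have hE : ∀ i, rieszL (y i) (P.p i) = ∑ z ∈ Δ i, v i z * ρ i z := fun i => by
    rw [rieszL_eq_sum_atoms (hy i) (h.p_support_subset hcv hp hq hk i)]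
    refine Finset.sum_congr rfl fun z hz => ?_
    rw [hv, hρ, mul_assoc, mul_div_cancel₀ _ (hqpos i z (hΔK i hz)).ne']
  have hobj : ∀ x : Fin n → ℝ, P.objective x = ∑ i, ρ i ((P.I i).restrict x) := fun x =>
    Finset.sum_congr rfl fun i _ => by
      simp only [hρ]
      rw [eval_extendZero_restrict (hp i), eval_extendZero_restrict (hq i)]
  choose z₀ hz₀ hmin using fun i => (Δ i).exists_min_image (ρ i) (hne i)
  obtain ⟨x₀, hx₀⟩ := hpoint z₀ hz₀
  have hx₀K : x₀ ∈ P.K := mem_K_of_restrict_mem_blockK hcv hJ fun i => by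
    rw [hx₀ i]
    exact hΔK i (hz₀ i)
  have hge : P.relaxObjective y ≤ P.objective x₀ := by
    obtain ⟨y', hy', hobj'⟩ := exists_isFeasible_of_mem_K hcv hKM hq hqpos hx₀K k
    rw [← hobj']
    exact h.2 y' hy'
  have hle : ∀ i ∈ Finset.univ, ρ i (z₀ i) ≤ rieszL (y i) (P.p i) := by
    intro i _
    rw [hE, ← one_mul (ρ i (z₀ i)), ← hv1 i, Finset.sum_mul]
    exact Finset.sum_le_sum fun z hz => mul_le_mul_of_nonneg_left (hmin i z hz) (hv0 i z hz).le
  have heq : ∑ i, ρ i (z₀ i) = ∑ i, rieszL (y i) (P.p i) := by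
    refine le_antisymm (Finset.sum_le_sum hle) ?_
    rw [hobj] at hge
    simp only [hx₀] at hge
    exact hge
  have hmean := (Finset.sum_eq_sum_iff_of_le hle).1 heq
  rw [hobj, relaxObjective]
  refine Finset.sum_congr rfl fun i hi => ?_
  rw [hE]
  refine eq_of_sum_mul_le (hv0 i) (hv1 i) (fun z hz => ?_) (hx i)
  rw [← hE, ← hmean i hi]
  exact hmin i z hz

end Extraction

theorem finite_points_of_atoms (hcover : ∀ l, ∃ i, l ∈ P.I i) (Δ : ∀ i, Finset (P.I i → ℝ)) :
    {x : Fin n → ℝ | ∀ i, (P.I i).restrict x ∈ Δ i}.Finite := by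
  have hinj : Function.Injective fun (x : Fin n → ℝ) (i : Fin N) => (P.I i).restrict x := by
    intro x x' hxx'
    ext l
    obtain ⟨i, hi⟩ := hcover l
    exact congrFun (congrFun hxx' i) ⟨l, hi⟩
  refine ((Set.Finite.pi' fun i => (Δ i).finite_toSet).preimage hinj.injOn).subset ?_
  exact fun x hx i => hx i

end SparseProblem

theorem theorem4 {n N m : ℕ} (P : SparseProblem n N m)
    (hcover : ∀ l, ∃ i, l ∈ P.I i)
    (hp : ∀ i, (P.p i).vars ⊆ P.I i)
    (hq : ∀ i, (P.q i).vars ⊆ P.I i)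
    (hJ : ∀ c, ∃! i, c ∈ P.J i)
    (hJball : ∀ i, Sum.inr i ∈ P.J i)
    (hg : ∀ i j, Sum.inl j ∈ P.J i → (P.g j).vars ⊆ P.I i)
    (hcompact : IsCompact P.K)
    (hM : 0 < P.M)
    (hKM : ∀ x ∈ P.K, ∑ l, x l ^ 2 ≤ P.M)
    (hqpos : ∀ i, ∀ z ∈ P.blockK i, 0 < MvPolynomial.eval (extendZero z) (P.q i))
    (hrip : P.RunningIntersection) :
    (MonotoneOn P.relaxVal {k | P.Admissible k} ∧
      Filter.Tendsto P.relaxVal Filter.atTop (nhds P.optVal)) ∧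
    ∀ (k : ℕ) (y : Fin N → (Fin n →₀ ℕ) → ℝ), P.Admissible k →
      (∀ i j, i < j → (P.I i ∩ P.I j).Nonempty →
        max (P.q i).totalDegree (P.q j).totalDegree + 1 ≤ 2 * k) →
      P.IsOptimal k y →
      (∀ i, (momentMatrix (y i) (P.I i) k).rank =
        (momentMatrix (y i) (P.I i) (k - P.blockHalfDeg i)).rank) →
      (∀ i j, i < j → (P.I i ∩ P.I j).Nonempty →
        (momentMatrix (y i) (P.I i ∩ P.I j) k).rank = 1 ∧
        (momentMatrix (y j) (P.I i ∩ P.I j) k).rank = 1) →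
      P.relaxVal k = P.optVal ∧
      ∃ (Δ : ∀ i, Finset (P.I i → ℝ)) (w : ∀ i, (P.I i → ℝ) → ℝ),
        (∀ i, (Δ i).card = (momentMatrix (y i) (P.I i) k).rank ∧ ↑(Δ i) ⊆ P.blockK i ∧
          (∀ z ∈ Δ i, 0 < w i z) ∧
          ∀ α ∈ monos (P.I i) (2 * k),
            y i α = ∑ z ∈ Δ i, w i z * MvPolynomial.eval (extendZero z)
              (MvPolynomial.monomial α 1)) ∧
        {x : Fin n → ℝ | ∀ i, (P.I i).restrict x ∈ Δ i}.Finite ∧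
        {x : Fin n → ℝ | ∀ i, (P.I i).restrict x ∈ Δ i}.Nonempty ∧
        ∀ x : Fin n → ℝ, (∀ i, (P.I i).restrict x ∈ Δ i) → P.IsGlobalMinimizer x := by
  have hcv : ∀ i, ∀ c ∈ P.J i, (P.con c).vars ⊆ P.I i := fun i c hc =>
    SparseProblem.con_vars hJ hJball hg hc
  refine ⟨⟨P.relaxVal_mono.monotoneOn _,
    SparseProblem.tendsto_relaxVal hcv hJ hJball hM hKM hp hq hqpos hrip⟩, ?_⟩
  intro k y hk hkq hopt hflat hrank
  choose Δ w hcard hΔK hw hy using fun i =>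
    SparseProblem.exists_atoms hcv hJball hk hopt.1 (hflat i)
  have hne : ∀ i, (Δ i).Nonempty := by
    intro i
    by_contra hempty
    have h1 := rieszL_eq_sum_atoms (hy i) (support_subset_monos_iff.2 ⟨hq i, hk.1 i⟩)
    rw [hopt.1.normalized, Finset.not_nonempty_iff_eq_empty.1 hempty, Finset.sum_empty] at h1
    exact one_ne_zero h1
  have hpoint : ∀ z : ∀ i, P.I i → ℝ, (∀ i, z i ∈ Δ i) →
      ∃ x : Fin n → ℝ, ∀ i, (P.I i).restrict x = z i := fun z hz =>
    SparseProblem.exists_point_of_atoms hcover (fun hij _ hz _ hz' _ hl hl' =>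
      SparseProblem.atoms_compatible hq hk hkq hopt.1 hrank hw hy hij hz hz' hl hl') hz
  have hobj : ∀ x : Fin n → ℝ, (∀ i, (P.I i).restrict x ∈ Δ i) →
      P.objective x = P.relaxObjective y := fun x hx =>
    hopt.objective_eq hcv hJ hKM hp hq hqpos hk hΔK hw hy hpoint hne hx
  have hmin : ∀ x : Fin n → ℝ, (∀ i, (P.I i).restrict x ∈ Δ i) → P.IsGlobalMinimizer x := by
    intro x hx
    refine ⟨SparseProblem.mem_K_of_restrict_mem_blockK hcv hJ fun i => hΔK i (hx i),
      fun x' hx' => ?_⟩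
    obtain ⟨y', hy', hobj'⟩ :=
      SparseProblem.exists_isFeasible_of_mem_K hcv hKM hq hqpos hx' k
    rw [hobj x hx, ← hobj']
    exact hopt.2 y' hy'
  obtain ⟨x, hx⟩ := hpoint (fun i => (hne i).choose) fun i => (hne i).choose_spec
  have hxΔ : ∀ i, (P.I i).restrict x ∈ Δ i := fun i => hx i ▸ (hne i).choose_spec
  refine ⟨le_antisymm (SparseProblem.relaxVal_le_optVal hcv hKM hq hqpos k) ?_, Δ, w,
    fun i => ⟨hcard i, hΔK i, hw i, hy i⟩, SparseProblem.finite_points_of_atoms hcover Δ,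
    ⟨x, hxΔ⟩, hmin⟩
  calc P.optVal ≤ (P.objective x : EReal) := iInf₂_le x (hmin x hxΔ).1
    _ = (P.relaxObjective y : EReal) := by rw [hobj x hxΔ]
    _ ≤ P.relaxVal k := le_iInf₂ fun y' hy' => EReal.coe_le_coe_iff.2 (hopt.2 y' hy')
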